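/- Let $\mathfrak g$ be a finite-dimensional semisimple complex Lie algebra, $\theta$ an involutive automorphism of $\mathfrak g$, $\mathfrak k$ its fixed point algebra (assumed reductive in $\mathfrak g$), $\mathfrak p$ the $(-1)$-eigenspace of $\theta$, and $\mathfrak h\subset\mathfrak k$ a Cartan subalgebra of $\mathfrak g$. A root of $(\mathfrak g,\mathfrak h)$ is compact (non-compact) if its root space lies in $\mathfrak k$ (in $\mathfrak p$). Let $P$ be a positive system of roots, with compact part $P_k$ and non-compact part $P_n$, and let $\mathfrak p^{+}=\bigoplus_{\beta\in P_n}\mathfrak g_\beta$. A root $\beta$ is totally positive (for $P$) if $\mathfrak g_\beta$ lies in an $\operatorname{ad}\mathfrak k$-stable subspace of $\mathfrak p^+$. Let $P_t$ be the set of totally positive roots, $\mathfrak p_t^{\pm}=\bigoplus_{\beta\in P_t}\mathfrak g_{\pm\beta}$, $\mathfrak p_t=\mathfrak p_t^+\oplus\mathfrak p_t^-$ and $\mathfrak g_t=[\mathfrak p_t,\mathfrak p_t]\oplus\mathfrak p_t$. The positive system $P$ is called admissible if $P_t\neq\emptyset$. (a) If $\beta$ is totally positive, then the $\operatorname{ad}\mathfrak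 k$-module generated by $\mathfrak g_\beta$ is irreducible, and any root $\gamma=\beta+\sigma$, where $\sigma$ is an integral linear combination of compact roots, is totally positive and its root space lies in that module. (b) If $\gamma$ is totally positive and $\alpha$ is a compact root, then at most $3$ roots are of the form $\gamma+n\alpha$ with $n\in\mathbb Z$. (c) If $\mathfrak g$ is simple, then either no root is totally positive or all positive non-compact roots are totally positive. (d) If $\mathfrak g=\mathfrak g_t$ is simple, then $P$ and $P^-=P_k\cup(-P_n)$ are distinct, and they are exactly the admissible positive systems containing $P_k$. More generally, suppose that $P$ is admissible and $P_n=P_t$ (this holds whenever $\mathfrak g=\mathfrak g_t\ne0$). Let $\mathfrak p_1^+,\dots,\mathfrak p_s^+$ be the irreducible $\mathfrak k$-submodules of $\mathfrak p_t^+$, and let $\mathfrak p_i^-$ be the span of the root spaces $\mathfrak g_{-\beta}$ with $\mathfrak g_\beta\subset\mathfrak p_i^+$. Then the number of admissible positive systems $P'\supset P_k$ all of whose non-compact roots are totally positive for $P'$ (i.e. $P'_n=P'_t$) is exactly $2^s$; if $\mathfrak g=\mathfrak g_t$, then $s$ is the number of simple ideals of $\mathfrak g$; and the root space of every non-compact root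 lies in exactly one of the $2s$ spaces $\mathfrak p_i^{\pm}$. -/

import Mathlib

open LieAlgebra LieModule

namespace HarishChandra

variable {g : Type*} [LieRing g] [LieAlgebra ℂ g]

/-- `(g, k)` is a Harish-Chandra pair over `ℂ` (for `g` semisimple) with involution `θ`: `k` is the
set of fixed points of the involutive automorphism `θ`, and `k` is reductive in `g`, i.e. `g` is a
completely reducible `k`-module under the adjoint action. -/
structure IsPair (k : LieSubalgebra ℂ g) (θ : g ≃ₗ⁅ℂ⁆ g) : Prop where
  involutive : ∀ x, θ (θ x) = x
  mem_iff : ∀ x, x ∈ k ↔ θ x = x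
  reductive : ComplementedLattice (LieSubmodule ℂ k g)

/-- The space `p`, the eigenspace of `θ` for the eigenvalue `-1`. -/
def pSpace (θ : g ≃ₗ⁅ℂ⁆ g) : Submodule ℂ g where
  carrier := {x | θ x = -x}
  add_mem' := by
    intro x y hx hy
    change θ (x + y) = -(x + y)
    change θ x = -x at hx
    change θ y = -y at hy
    rw [map_add, hx, hy, neg_add]
  zero_mem' := by simp
  smul_mem' := by
    intro c x hx
    change θ (c • x) = -(c • x)
    change θ x = -x at hx
    rw [map_smul, hx, smul_neg]

section Roots

variable [FiniteDimensional ℂ g] [LieAlgebra.IsSemisimple ℂ g]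
variable (k : LieSubalgebra ℂ g) (θ : g ≃ₗ⁅ℂ⁆ g)
variable (H : LieSubalgebra ℂ g) [H.IsCartanSubalgebra]

/-- `α` is a compact root: a root whose root space lies in `k`. -/
def IsCompactRoot (α : Weight ℂ H g) : Prop :=
  α ∈ H.root ∧ (rootSpace H α).toSubmodule ≤ k.toSubmodule

/-- `α` is a non-compact root: a root whose root space lies in `p`. -/
def IsNoncompactRoot (α : Weight ℂ H g) : Prop :=
  α ∈ H.root ∧ (rootSpace H α).toSubmodule ≤ pSpace θ

/-- A positive system of roots: the set of roots is the disjoint union of `P` and `-P`, and any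
root which is a sum of two elements of `P` is in `P`. -/
structure IsPositiveSystem (P : Set (Weight ℂ H g)) : Prop where
  isRoot : ∀ α ∈ P, α ∈ H.root
  mem_or_neg_mem : ∀ α ∈ H.root, α ∈ P ∨ -α ∈ P
  neg_notMem : ∀ α ∈ P, -α ∉ P
  add_mem : ∀ α ∈ P, ∀ β ∈ P, ∀ γ ∈ H.root,
    Weight.toLinear ℂ H g γ = Weight.toLinear ℂ H g α + Weight.toLinear ℂ H g β → γ ∈ P

/-- `P_k`, the compact roots in `P`. -/
def compactPart (P : Set (Weight ℂ H g)) : Set (Weight ℂ H g) :=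
  {α | α ∈ P ∧ IsCompactRoot k H α}

/-- `P_n`, the non-compact roots in `P`. -/
def noncompactPart (P : Set (Weight ℂ H g)) : Set (Weight ℂ H g) :=
  {α | α ∈ P ∧ IsNoncompactRoot θ H α}

/-- The set `-S`. -/
def negSet (S : Set (Weight ℂ H g)) : Set (Weight ℂ H g) := {α | -α ∈ S}

/-- The span of the root spaces of the roots in `S`. -/
def rootSpan (S : Set (Weight ℂ H g)) : Submodule ℂ g :=
  ⨆ α ∈ S, (rootSpace H α).toSubmodule

/-- The root `β` is totally positive with respect to `P`: its root space is contained in an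
`ad k`-stable subspace `m` of `p⁺`, the span of the root spaces of the roots in `P_n`. -/
def IsTotallyPositive (P : Set (Weight ℂ H g)) (β : Weight ℂ H g) : Prop :=
  β ∈ H.root ∧ ∃ m : LieSubmodule ℂ k g,
    m.toSubmodule ≤ rootSpan H (noncompactPart θ H P) ∧
      (rootSpace H β).toSubmodule ≤ m.toSubmodule

/-- `P_t`, the set of totally positive roots. -/
def totallyPositiveRoots (P : Set (Weight ℂ H g)) : Set (Weight ℂ H g) :=
  {β | IsTotallyPositive k θ H P β}

/-- The positive system `P` is admissible: there are totally positive roots. -/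
def IsAdmissible (P : Set (Weight ℂ H g)) : Prop :=
  (totallyPositiveRoots k θ H P).Nonempty

/-- `p_t⁺`, the span of the root spaces of the totally positive roots. -/
def ptPlus (P : Set (Weight ℂ H g)) : Submodule ℂ g :=
  rootSpan H (totallyPositiveRoots k θ H P)

/-- `p_t = p_t⁺ + p_t⁻`. -/
def pt (P : Set (Weight ℂ H g)) : Submodule ℂ g :=
  ptPlus k θ H P ⊔ rootSpan H (negSet H (totallyPositiveRoots k θ H P))

/-- `g_t = [p_t, p_t] + p_t`. -/
def gt (P : Set (Weight ℂ H g)) : Submodule ℂ g :=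
  Submodule.span ℂ {z | ∃ x ∈ pt k θ H P, ∃ y ∈ pt k θ H P, ⁅x, y⁆ = z} ⊔ pt k θ H P

/-- The irreducible `k`-submodules `p_i⁺` of `p_t⁺`. As the weights of `p_t⁺` have multiplicity
one, these are exactly the summands in its decomposition into irreducible `k`-modules. -/
def components (P : Set (Weight ℂ H g)) : Set (LieSubmodule ℂ k g) :=
  {N | LieModule.IsIrreducible ℂ k N ∧ N.toSubmodule ≤ ptPlus k θ H P}

/-- For `N = p_i⁺`, the space `p_i⁻`: the span of the root spaces of the roots `-β` with
`g_β ⊆ N`. -/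
def opposite (N : LieSubmodule ℂ k g) : Submodule ℂ g :=
  rootSpan H (negSet H {β | β ∈ H.root ∧ (rootSpace H β).toSubmodule ≤ N.toSubmodule})

/-- For `N = p_i⁺`, the space `p_i⁺` (for `true`) or `p_i⁻` (for `false`). -/
def signed (N : LieSubmodule ℂ k g) (ε : Bool) : Submodule ℂ g :=
  if ε then N.toSubmodule else opposite k H N

/-- The `k`-module generated by the root space of `β`. -/
def generated (β : Weight ℂ H g) : LieSubmodule ℂ k g :=
  LieSubmodule.lieSpan ℂ k (rootSpace H β : Set g)

end Roots

end HarishChandra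

/-! Everything is reduced to combinatorics of roots. Since `H ≤ k`, the involution fixes `H`
pointwise, so each root is compact or non-compact, and compactness behaves like a ℤ/2-grading under
sums of roots. A `k`-stable span of root spaces in `p` then corresponds to a set of non-compact
roots closed under adding compact roots (`KStable`). Root spaces are lines, so complete reducibility
forces the `k`-module generated by one to be irreducible; its set of roots is `component`, and a
non-compact root is totally positive exactly when its component lies in `P`.

The main observation is `IsPair.neg_mem_of_add`: if β lies in a `k`-stable set S, γ is non-compact
and β + γ is a root, then β + γ is compact and -γ = β - (β + γ) lies in S. Thus inside a `k`-stable
subset of `P` no two roots add up to a root, and all pairings are non-negative.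

For (a), the sum of the roots of a component is invariant under compact reflections, hence
orthogonal to the compact roots. A root γ congruent to β modulo compact roots therefore has positive
inner product with this sum, so with some member m; either m = γ or m - γ is a root, and the
observation puts γ in the component. For (b), a string with more than three roots would contain two
roots of the component with negative pairing.

For (c), if S is `k`-stable and symmetric, the non-compact root spaces outside S commute with those
in S, so [m, m] + m is an ideal, where m is the span for S. In a simple algebra a nonempty S is then
the set of all non-compact roots.

For (d), any choice of sign for each component, together with `P_k`, is again a positive system,
because sums of chosen non-compact roots are never roots; conversely, total positivity forces a
positive system to contain a component entirely or not at all. The ideals generated by the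
components are the simple ideals. -/

namespace HarishChandra

set_option linter.unusedSectionVars false

variable {g : Type*} [LieRing g] [LieAlgebra ℂ g]
variable [FiniteDimensional ℂ g] [LieAlgebra.IsSemisimple ℂ g]

/-! ### Root spaces and spans of root spaces. -/

section RootSpaces

variable {H : LieSubalgebra ℂ g} [H.IsCartanSubalgebra]

lemma weight_ext {α β : Weight ℂ H g}
    (h : Weight.toLinear ℂ H g α = Weight.toLinear ℂ H g β) : α = β := by
  ext x; exact LinearMap.congr_fun h x

lemma isNonZero_of_mem {α : Weight ℂ H g} (hα : α ∈ H.root) : α.IsNonZero := by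
  simpa using hα

lemma neg_mem_root {α : Weight ℂ H g} (hα : α ∈ H.root) : -α ∈ H.root := by
  simpa using hα

lemma rootSpace_eq_span {α : Weight ℂ H g} (hα : α ∈ H.root) {e : g}
    (he : e ∈ rootSpace H α) (h0 : e ≠ 0) : (rootSpace H α).toSubmodule = ℂ ∙ e := by
  have h1 := IsKilling.finrank_rootSpace_eq_one α (isNonZero_of_mem hα)
  apply le_antisymm
  · intro x hx
    obtain ⟨c, hc⟩ := (finrank_eq_one_iff_of_nonzero' (⟨e, he⟩ : rootSpace H α)
      (by simpa using h0)).mp h1 ⟨x, hx⟩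
    exact Submodule.mem_span_singleton.mpr ⟨c, by simpa using congrArg Subtype.val hc⟩
  · simpa using he

lemma rootSpace_le_of_mem {α : Weight ℂ H g} (hα : α ∈ H.root) {e : g}
    (he : e ∈ rootSpace H α) (h0 : e ≠ 0) {W : Submodule ℂ g} (hW : e ∈ W) :
    (rootSpace H α).toSubmodule ≤ W := by
  rw [rootSpace_eq_span hα he h0]; simpa using hW

lemma mem_rootSpace_iff {α : H → ℂ} {x : g} :
    x ∈ rootSpace H α ↔ ∀ h : H, ⁅h, x⁆ = α h • x := by
  refine ⟨fun hx h ↦ IsKilling.lie_eq_smul_of_mem_rootSpace hx h, fun hx ↦ ?_⟩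
  exact (mem_genWeightSpace g α x).mpr fun h ↦ ⟨1, by simp [hx h]⟩

/-- This follows from the independence of the weight spaces; it turns inclusions of subspaces into
membership of roots. -/
lemma mem_of_mem_rootSpan {S : Set (Weight ℂ H g)} {β : Weight ℂ H g} {x : g}
    (hx : x ∈ rootSpace H β) (h0 : x ≠ 0) (hS : x ∈ rootSpan H S) : β ∈ S := by
  by_contra hβ
  have hind := iSupIndep_genWeightSpace' ℂ H g
  rw [← LieSubmodule.iSupIndep_toSubmodule] at hind
  have hle : rootSpan H S ≤ ⨆ (χ : Weight ℂ H g) (_ : χ ≠ β), (genWeightSpace g χ).toSubmodule :=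
    iSup₂_le fun χ hχ ↦ le_iSup₂_of_le χ (fun h ↦ hβ (h ▸ hχ)) le_rfl
  exact h0 ((Submodule.disjoint_def.mp (hind β)) x hx (hle hS))

lemma rootSpace_le_rootSpan {S : Set (Weight ℂ H g)} {β : Weight ℂ H g} (hβ : β ∈ S) :
    (rootSpace H β).toSubmodule ≤ rootSpan H S := le_iSup₂_of_le β hβ le_rfl

lemma rootSpace_le_rootSpan_iff {S : Set (Weight ℂ H g)} {β : Weight ℂ H g} :
    (rootSpace H β).toSubmodule ≤ rootSpan H S ↔ β ∈ S := by
  refine ⟨fun h ↦ ?_, rootSpace_le_rootSpan⟩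
  obtain ⟨x, hx, h0⟩ := β.exists_ne_zero
  exact mem_of_mem_rootSpan hx h0 (h hx)

lemma rootSpan_mono {S T : Set (Weight ℂ H g)} (h : S ⊆ T) : rootSpan H S ≤ rootSpan H T :=
  biSup_mono h

lemma lie_mem_rootSpace {α β γ : Weight ℂ H g}
    (h : Weight.toLinear ℂ H g γ = Weight.toLinear ℂ H g α + Weight.toLinear ℂ H g β)
    {x y : g} (hx : x ∈ rootSpace H α) (hy : y ∈ rootSpace H β) : ⁅x, y⁆ ∈ rootSpace H γ := by
  have h1 := lie_mem_genWeightSpace_of_mem_genWeightSpace hx hy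
  have h2 : (γ : H → ℂ) = α + β := by
    ext z; exact LinearMap.congr_fun h z
  rw [h2]; exact h1

lemma exists_weight_of_lie_ne_zero {α β : Weight ℂ H g} {x y : g}
    (hx : x ∈ rootSpace H α) (hy : y ∈ rootSpace H β) (h : ⁅x, y⁆ ≠ 0) :
    ∃ γ : Weight ℂ H g,
      Weight.toLinear ℂ H g γ = Weight.toLinear ℂ H g α + Weight.toLinear ℂ H g β := by
  have h1 := lie_mem_genWeightSpace_of_mem_genWeightSpace hx hy
  refine ⟨⟨α + β, fun h0 ↦ h ?_⟩, ?_⟩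
  · rw [h0] at h1; simpa using h1
  · ext z; rfl

lemma mem_H_of_lie {α : Weight ℂ H g} {x y : g}
    (hx : x ∈ rootSpace H α) (hy : y ∈ rootSpace H (-α)) : ⁅x, y⁆ ∈ H := by
  have h1 := lie_mem_genWeightSpace_of_mem_genWeightSpace hx hy
  rw [show (α : H → ℂ) + -α = 0 by simp] at h1
  have h2 := rootSpace_zero_eq ℂ g H
  rw [← LieSubalgebra.mem_toLieSubmodule, ← h2]; exact h1

lemma rootSpace_eq_of_notMem_root {α : Weight ℂ H g} (hα : α ∉ H.root) :
    (rootSpace H α).toSubmodule = H.toSubmodule := by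
  have h0 : α.IsZero := by simpa using hα
  have h2 := rootSpace_zero_eq ℂ g H
  rw [h0.eq, h2]; rfl

/-- By sl₂-theory, root strings are irreducible enough that a raising step between two weights is
never zero. This is what transfers membership in `k`, `p` or a `k`-submodule from root spaces to
sums of roots. -/
lemma exists_lie_ne_zero {α β γ : Weight ℂ H g} (hα : α ∈ H.root)
    (h : Weight.toLinear ℂ H g γ = Weight.toLinear ℂ H g α + Weight.toLinear ℂ H g β) :
    ∃ x ∈ rootSpace H α, ∃ y ∈ rootSpace H β, ⁅x, y⁆ ≠ 0 := by
  have hα' := isNonZero_of_mem hα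
  have hα'' := isNonZero_of_mem (neg_mem_root hα)
  -- The triple is taken for -α, so that f lies in the root space of α and v, at the top of the
  -- (-α)-chain through β, is primitive for e.
  obtain ⟨v, hv, v0⟩ := (chainTop (-α) β).exists_ne_zero
  obtain ⟨h', e, f, isSl2, he, hf⟩ := IsKilling.exists_isSl2Triple_of_weight_isNonZero hα''
  obtain rfl := isSl2.h_eq_coroot hα'' he hf
  have prim : isSl2.HasPrimitiveVectorWith v (IsKilling.chainLength (-α) β : ℂ) :=
    have := lie_mem_genWeightSpace_of_mem_genWeightSpace he hv
    ⟨v0, (IsKilling.chainLength_smul _ _ hv).symm, by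
      rwa [Weight.coe_neg, genWeightSpace_add_chainTop _ _ (by simpa using hα''),
        LieSubmodule.mem_bot] at this⟩
  have hf' : f ∈ rootSpace H α := by simpa using hf
  -- Applying f `chainTopCoeff` times brings v to weight β. As β + α is a weight, the chain
  -- continues for at least one more step, so the next power of f does not kill v.
  have hle : chainTopCoeff (-α) β + 1 ≤ IsKilling.chainLength (-α) β := by
    rw [← IsKilling.chainBotCoeff_add_chainTopCoeff]
    have := (IsKilling.rootSpace_zsmul_add_ne_bot_iff (-α) β hα'' (-1)).mp (by
      have h2 : (γ : H → ℂ) = α + β := by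
        ext z; exact LinearMap.congr_fun h z
      have := γ.genWeightSpace_ne_bot
      rw [h2] at this
      simpa using this)
    omega
  refine ⟨f, hf', ((toEnd ℂ g g f) ^ (chainTopCoeff (-α) β)) v, ?_, ?_⟩
  · have := toEnd_pow_apply_mem hf hv (chainTopCoeff (-α) β)
    convert! this using 2
    rw [coe_chainTop']
    simp
  · rw [prim.lie_f_pow_toEnd_f]
    exact prim.pow_toEnd_f_ne_zero_of_eq_nat rfl hle

lemma rootSpace_le_of_lie_mem {α β γ : Weight ℂ H g} (hα : α ∈ H.root) (hγ : γ ∈ H.root)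
    (h : Weight.toLinear ℂ H g γ = Weight.toLinear ℂ H g α + Weight.toLinear ℂ H g β)
    {W : Submodule ℂ g} (hW : ∀ x ∈ rootSpace H α, ∀ y ∈ rootSpace H β, ⁅x, y⁆ ∈ W) :
    (rootSpace H γ).toSubmodule ≤ W := by
  obtain ⟨x, hx, y, hy, h0⟩ := exists_lie_ne_zero hα h
  exact rootSpace_le_of_mem hγ (lie_mem_rootSpace h hx hy) h0 (hW x hx y hy)

/-- A root space lies in one of two complementary subspaces stable under the Cartan subalgebra. -/
lemma rootSpace_le_or_le {β : Weight ℂ H g} (hβ : β ∈ H.root) {W W' : Submodule ℂ g}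
    (hc : IsCompl W W') (hW : ∀ h : H, ∀ x ∈ W, ⁅(h : g), x⁆ ∈ W)
    (hW' : ∀ h : H, ∀ x ∈ W', ⁅(h : g), x⁆ ∈ W') :
    (rootSpace H β).toSubmodule ≤ W ∨ (rootSpace H β).toSubmodule ≤ W' := by
  obtain ⟨e, he, h0⟩ := β.exists_ne_zero
  obtain ⟨w, hw, w', hw', hs⟩ := Submodule.mem_sup.mp (hc.sup_eq_top ▸ Submodule.mem_top (x := e))
  -- Both subspaces are stable under `H`, so each component of the root vector is itself a vector of
  -- weight β; a nonzero one spans the root space.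
  have key : ∀ h : H, ⁅(h : g), w⁆ - β h • w = 0 ∧ ⁅(h : g), w'⁆ - β h • w' = 0 := by
    intro h
    have h1 : (⁅(h : g), w⁆ - β h • w) + (⁅(h : g), w'⁆ - β h • w') = 0 := by
      have := mem_rootSpace_iff.mp he h
      rw [← hs, LieSubalgebra.coe_bracket_of_module, lie_add, smul_add] at this
      rw [← sub_eq_zero] at this
      rw [← this]; abel
    have h2 : ⁅(h : g), w⁆ - β h • w ∈ W := W.sub_mem (hW h w hw) (W.smul_mem _ hw)
    have h3 : ⁅(h : g), w'⁆ - β h • w' ∈ W' := W'.sub_mem (hW' h w' hw') (W'.smul_mem _ hw')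
    have h4 : ⁅(h : g), w⁆ - β h • w = 0 := by
      refine (Submodule.disjoint_def.mp hc.disjoint) _ h2 ?_
      rw [eq_neg_of_add_eq_zero_left h1]
      exact W'.neg_mem h3
    refine ⟨h4, ?_⟩
    rwa [h4, zero_add] at h1
  have hwβ : w ∈ rootSpace H β := mem_rootSpace_iff.mpr fun h ↦ sub_eq_zero.mp (key h).1
  have hwβ' : w' ∈ rootSpace H β := mem_rootSpace_iff.mpr fun h ↦ sub_eq_zero.mp (key h).2
  by_cases hw0 : w = 0
  · right
    refine rootSpace_le_of_mem hβ hwβ' (fun h ↦ h0 ?_) hw'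
    rw [← hs, hw0, h, add_zero]
  · exact Or.inl (rootSpace_le_of_mem hβ hwβ hw0 hw)

lemma iSup_rootSpace_eq_top :
    H.toSubmodule ⊔ rootSpan H {α | α ∈ H.root} = ⊤ := by
  have h := iSup_genWeightSpace_eq_top' ℂ H g
  rw [← LieSubmodule.toSubmodule_inj, LieSubmodule.iSup_toSubmodule,
    LieSubmodule.top_toSubmodule] at h
  rw [eq_top_iff, ← h]
  refine iSup_le fun χ ↦ ?_
  by_cases hχ : χ ∈ H.root
  · exact le_sup_of_le_right (rootSpace_le_rootSpan hχ)
  · exact le_sup_of_le_left (rootSpace_eq_of_notMem_root hχ).le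

end RootSpaces

/-! ### Compact and non-compact roots, and `k`-stable sets of roots. -/

section Types

variable {H : LieSubalgebra ℂ g} [H.IsCartanSubalgebra]

lemma lie_mem_of_forall {S T : Set (Weight ℂ H g)} {W : Submodule ℂ g}
    (h : ∀ α ∈ S, ∀ x ∈ rootSpace H α, ∀ β ∈ T, ∀ y ∈ rootSpace H β, ⁅x, y⁆ ∈ W)
    {x y : g} (hx : x ∈ rootSpan H S) (hy : y ∈ rootSpan H T) : ⁅x, y⁆ ∈ W := by
  have h1 : ∀ α ∈ S, ∀ x ∈ rootSpace H α, ⁅x, y⁆ ∈ W := by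
    intro α hα x hx
    have : rootSpan H T ≤ W.comap (ad ℂ g x : g →ₗ[ℂ] g) :=
      iSup₂_le fun β hβ z hz ↦ h α hα x hx β hβ z hz
    exact this hy
  have : rootSpan H S ≤ W.comap (ad ℂ g y : g →ₗ[ℂ] g) := by
    refine iSup₂_le fun α hα z hz ↦ ?_
    change ⁅y, z⁆ ∈ W
    rw [← lie_skew]
    exact W.neg_mem (h1 α hα z hz)
  have h2 : ⁅y, x⁆ ∈ W := this hx
  rw [← lie_skew]
  exact W.neg_mem h2

lemma lie_mem_rootSpan (S : Set (Weight ℂ H g)) {x y : g} (hx : x ∈ H)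
    (hy : y ∈ rootSpan H S) : ⁅x, y⁆ ∈ rootSpan H S := by
  have : rootSpan H S ≤ (rootSpan H S).comap (ad ℂ g x : g →ₗ[ℂ] g) := by
    refine iSup₂_le fun α hα z hz ↦ ?_
    change ⁅x, z⁆ ∈ rootSpan H S
    exact rootSpace_le_rootSpan hα ((rootSpace H α).lie_mem (x := ⟨x, hx⟩) hz)
  exact this hy

variable {k : LieSubalgebra ℂ g} {θ : g ≃ₗ⁅ℂ⁆ g}

lemma mem_pSpace {x : g} : x ∈ pSpace θ ↔ θ x = -x := Iff.rfl

namespace IsPair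

variable (hk : IsPair k θ)
include hk

lemma disjoint : Disjoint k.toSubmodule (pSpace θ) := by
  rw [Submodule.disjoint_def]
  intro x hx hx'
  have h1 : θ x = x := (hk.mem_iff x).mp hx
  rw [mem_pSpace, h1] at hx'
  have : IsAddTorsionFree g := .of_isTorsionFree ℂ g
  exact self_eq_neg.mp hx'

lemma lie_mem_p {x y : g} (hx : x ∈ k) (hy : y ∈ pSpace θ) : ⁅x, y⁆ ∈ pSpace θ := by
  rw [mem_pSpace] at *
  rw [LieEquiv.map_lie, hy, (hk.mem_iff x).mp hx, lie_neg]

lemma lie_mem_k {x y : g} (hx : x ∈ pSpace θ) (hy : y ∈ pSpace θ) : ⁅x, y⁆ ∈ k := by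
  rw [mem_pSpace] at *
  rw [hk.mem_iff, LieEquiv.map_lie, hx, hy, lie_neg, neg_lie, neg_neg]

lemma compact_or_noncompact (hH : H ≤ k) {α : Weight ℂ H g} (hα : α ∈ H.root) :
    IsCompactRoot k H α ∨ IsNoncompactRoot θ H α := by
  obtain ⟨e, he, h0⟩ := α.exists_ne_zero
  -- θ fixes `H` pointwise, hence preserves the line g_α and acts on it by a scalar of square 1.
  have h1 : θ e ∈ rootSpace H α := by
    rw [mem_rootSpace_iff]
    intro h
    have h2 := mem_rootSpace_iff.mp he h
    rw [LieSubalgebra.coe_bracket_of_module] at h2 ⊢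
    have h3 : θ (h : g) = h := (hk.mem_iff _).mp (hH h.2)
    rw [← h3, ← LieEquiv.map_lie, h2, map_smul]
  rw [← LieSubmodule.mem_toSubmodule, rootSpace_eq_span hα he h0,
    Submodule.mem_span_singleton] at h1
  obtain ⟨c, hc⟩ := h1
  have h4 : (c * c) • e = (1 : ℂ) • e := by
    rw [mul_smul, hc, ← map_smul, hc, hk.involutive, one_smul]
  have h5 : c * c = 1 := smul_left_injective ℂ h0 h4
  rcases mul_self_eq_one_iff.mp h5 with rfl | rfl
  · left
    refine ⟨hα, rootSpace_le_of_mem hα he h0 ?_⟩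
    exact (hk.mem_iff e).mpr (by rw [← hc, one_smul])
  · right
    refine ⟨hα, rootSpace_le_of_mem hα he h0 ?_⟩
    rw [mem_pSpace, ← hc, neg_smul, one_smul]

lemma not_compact {α : Weight ℂ H g} (hα : IsNoncompactRoot θ H α) : ¬ IsCompactRoot k H α := by
  intro h
  obtain ⟨e, he, h0⟩ := α.exists_ne_zero
  exact h0 (Submodule.disjoint_def.mp hk.disjoint e (h.2 he) (hα.2 he))

lemma compact_add {α β γ : Weight ℂ H g} (hα : IsCompactRoot k H α) (hβ : IsCompactRoot k H β)
    (hγ : γ ∈ H.root)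
    (h : Weight.toLinear ℂ H g γ = Weight.toLinear ℂ H g α + Weight.toLinear ℂ H g β) :
    IsCompactRoot k H γ :=
  ⟨hγ, rootSpace_le_of_lie_mem hα.1 hγ h fun _ hx _ hy ↦ k.lie_mem (hα.2 hx) (hβ.2 hy)⟩

lemma compact_add_noncompact {α β γ : Weight ℂ H g} (hα : IsCompactRoot k H α)
    (hβ : IsNoncompactRoot θ H β) (hγ : γ ∈ H.root)
    (h : Weight.toLinear ℂ H g γ = Weight.toLinear ℂ H g α + Weight.toLinear ℂ H g β) :
    IsNoncompactRoot θ H γ :=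
  ⟨hγ, rootSpace_le_of_lie_mem hα.1 hγ h fun _ hx _ hy ↦ hk.lie_mem_p (hα.2 hx) (hβ.2 hy)⟩

lemma noncompact_add {α β γ : Weight ℂ H g} (hα : IsNoncompactRoot θ H α)
    (hβ : IsNoncompactRoot θ H β) (hγ : γ ∈ H.root)
    (h : Weight.toLinear ℂ H g γ = Weight.toLinear ℂ H g α + Weight.toLinear ℂ H g β) :
    IsCompactRoot k H γ :=
  ⟨hγ, rootSpace_le_of_lie_mem hα.1 hγ h fun _ hx _ hy ↦ hk.lie_mem_k (hα.2 hx) (hβ.2 hy)⟩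

/-- If g_{-α} were in `p`, then [g_α, g_{-α}] would lie in `p` and in `H ≤ k`, hence vanish; but it
contains a nonzero coroot. -/
lemma compact_neg (hH : H ≤ k) {α : Weight ℂ H g} (hα : IsCompactRoot k H α) :
    IsCompactRoot k H (-α) := by
  refine (hk.compact_or_noncompact hH (neg_mem_root hα.1)).resolve_right fun hn ↦ ?_
  obtain ⟨h, e, f, t, he, hf⟩ :=
    IsKilling.exists_isSl2Triple_of_weight_isNonZero (isNonZero_of_mem hα.1)
  have h1 : ⁅e, f⁆ ∈ k := hH (mem_H_of_lie he hf)
  have h2 : ⁅e, f⁆ ∈ pSpace θ := hk.lie_mem_p (hα.2 he) (hn.2 (by simpa using hf))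
  apply t.h_ne_zero
  rw [← t.lie_e_f]
  exact Submodule.disjoint_def.mp hk.disjoint _ h1 h2

lemma noncompact_neg (hH : H ≤ k) {α : Weight ℂ H g} (hα : IsNoncompactRoot θ H α) :
    IsNoncompactRoot θ H (-α) := by
  refine (hk.compact_or_noncompact hH (neg_mem_root hα.1)).resolve_left fun hn ↦ ?_
  have := hk.compact_neg hH hn
  rw [neg_neg] at this
  exact hk.not_compact hα this

lemma rootSpan_compact_le : rootSpan H {α | IsCompactRoot k H α} ≤ k.toSubmodule :=
  iSup₂_le fun _ h ↦ h.2

lemma rootSpan_noncompact_le : rootSpan H {α | IsNoncompactRoot θ H α} ≤ pSpace θ :=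
  iSup₂_le fun _ h ↦ h.2

lemma sup_eq_top (hH : H ≤ k) : H.toSubmodule ⊔ rootSpan H {α | IsCompactRoot k H α} ⊔
    rootSpan H {α | IsNoncompactRoot θ H α} = ⊤ := by
  rw [eq_top_iff, ← iSup_rootSpace_eq_top (H := H)]
  refine sup_le (le_sup_of_le_left le_sup_left) (iSup₂_le fun α hα ↦ ?_)
  rcases hk.compact_or_noncompact hH hα with h | h
  · exact le_sup_of_le_left (le_sup_of_le_right (rootSpace_le_rootSpan h))
  · exact le_sup_of_le_right (rootSpace_le_rootSpan h)

lemma k_eq (hH : H ≤ k) :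
    k.toSubmodule = H.toSubmodule ⊔ rootSpan H {α | IsCompactRoot k H α} := by
  have hle : H.toSubmodule ⊔ rootSpan H {α | IsCompactRoot k H α} ≤ k.toSubmodule :=
    sup_le hH hk.rootSpan_compact_le
  refine le_antisymm (fun x hx ↦ ?_) hle
  obtain ⟨a, ha, b, hb, rfl⟩ :=
    Submodule.mem_sup.mp (hk.sup_eq_top hH ▸ Submodule.mem_top (x := x))
  have hb' : b ∈ k.toSubmodule := by
    have := k.toSubmodule.sub_mem hx (hle ha)
    rwa [add_sub_cancel_left] at this
  have := Submodule.disjoint_def.mp hk.disjoint b hb' (hk.rootSpan_noncompact_le hb)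
  rwa [this, add_zero]

end IsPair

/-- A set of non-compact roots which contains every root obtained from one of its elements by
adding a compact root. -/
structure KStable (k : LieSubalgebra ℂ g) (θ : g ≃ₗ⁅ℂ⁆ g) (S : Set (Weight ℂ H g)) : Prop where
  noncompact : ∀ β ∈ S, IsNoncompactRoot θ H β
  add_mem : ∀ β ∈ S, ∀ α, IsCompactRoot k H α → ∀ γ ∈ H.root,
    Weight.toLinear ℂ H g γ = Weight.toLinear ℂ H g β + Weight.toLinear ℂ H g α → γ ∈ S

namespace KStable

variable {S T : Set (Weight ℂ H g)}

lemma union (hS : KStable k θ S) (hT : KStable k θ T) : KStable k θ (S ∪ T) where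
  noncompact := by
    rintro β (h | h)
    exacts [hS.noncompact β h, hT.noncompact β h]
  add_mem := by
    rintro β (h | h) α hα γ hγ hs
    exacts [Or.inl (hS.add_mem β h α hα γ hγ hs), Or.inr (hT.add_mem β h α hα γ hγ hs)]

lemma negSet (hS : KStable k θ S) (hk : IsPair k θ) (hH : H ≤ k) :
    KStable k θ (negSet H S) where
  noncompact β hβ := by
    have := hk.noncompact_neg hH (hS.noncompact _ hβ)
    rwa [neg_neg] at this
  add_mem β hβ α hα γ hγ hs := hS.add_mem (-β) hβ (-α) (hk.compact_neg hH hα) (-γ)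
    (neg_mem_root hγ) (by simp only [Weight.toLinear_neg, hs]; abel)

lemma lie_mem (hS : KStable k θ S) (hk : IsPair k θ) (hH : H ≤ k) {x y : g} (hx : x ∈ k)
    (hy : y ∈ rootSpan H S) : ⁅x, y⁆ ∈ rootSpan H S := by
  rw [← LieSubalgebra.mem_toSubmodule, hk.k_eq hH] at hx
  obtain ⟨a, ha, b, hb, rfl⟩ := Submodule.mem_sup.mp hx
  rw [add_lie]
  refine (rootSpan H S).add_mem (lie_mem_rootSpan S ha hy) (lie_mem_of_forall ?_ hb hy)
  intro α hα u hu β hβ v hv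
  by_cases h0 : ⁅u, v⁆ = 0
  · rw [h0]; exact Submodule.zero_mem _
  obtain ⟨γ, hγ⟩ := exists_weight_of_lie_ne_zero hu hv h0
  -- Weight zero would mean β = -α, which is compact.
  have hγr : γ ∈ H.root := by
    by_contra hγr
    have hz : γ.IsZero := by simpa using hγr
    rw [Weight.coe_toLinear_eq_zero_iff.mpr hz] at hγ
    have : β = -α := weight_ext (by
      rw [Weight.toLinear_neg]; exact (neg_eq_of_add_eq_zero_right hγ.symm).symm)
    exact hk.not_compact (hS.noncompact β hβ) (this ▸ hk.compact_neg hH hα)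
  exact rootSpace_le_rootSpan (hS.add_mem β hβ α hα γ hγr (by rw [hγ, add_comm]))
    (lie_mem_rootSpace hγ hu hv)

/-- The `k`-submodule spanned by the root spaces of a `k`-stable set of roots. -/
def submodule (hS : KStable k θ S) (hk : IsPair k θ) (hH : H ≤ k) : LieSubmodule ℂ k g where
  __ := rootSpan H S
  lie_mem {x _} hm := hS.lie_mem hk hH x.2 hm

lemma generated_le (hS : KStable k θ S) (hk : IsPair k θ) (hH : H ≤ k) {β : Weight ℂ H g}
    (hβ : β ∈ S) : (generated k H β).toSubmodule ≤ rootSpan H S := by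
  have : generated k H β ≤ hS.submodule hk hH :=
    LieSubmodule.lieSpan_le.mpr (rootSpace_le_rootSpan hβ)
  exact this

end KStable
end Types

/-! ### Irreducible `k`-modules generated by root spaces, and total positivity. -/

lemma isIrreducible_iff_isAtom {L M : Type*} [LieRing L] [LieAlgebra ℂ L] [AddCommGroup M]
    [Module ℂ M] [LieRingModule L M] (N : LieSubmodule ℂ L M) :
    LieModule.IsIrreducible ℂ L N ↔ IsAtom N := by
  have hinj : Function.Injective N.incl := Subtype.coe_injective
  let e : LieSubmodule ℂ L N ≃o Set.Iic N :=
    { toFun := fun A ↦ ⟨A.map N.incl, Set.mem_Iic.mpr LieSubmodule.map_incl_le⟩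
      invFun := fun B ↦ B.1.comap N.incl
      left_inv := fun A ↦ LieSubmodule.comap_map_eq A N.incl N.ker_incl
      right_inv := fun B ↦ Subtype.ext <| (LieSubmodule.map_comap_incl N B.1).trans <|
        inf_eq_right.mpr B.2
      map_rel_iff' := (LieSubmodule.mapOrderEmbedding hinj).le_iff_le }
  rw [LieModule.IsIrreducible, e.isSimpleOrder_iff, Set.isSimpleOrder_Iic_iff_isAtom]

section Components

variable {H : LieSubalgebra ℂ g} [H.IsCartanSubalgebra]
variable {k : LieSubalgebra ℂ g} {θ : g ≃ₗ⁅ℂ⁆ g}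

/-- The set of roots whose root spaces lie in the `k`-module generated by the root space of `β`. -/
def component (k : LieSubalgebra ℂ g) (β : Weight ℂ H g) : Set (Weight ℂ H g) :=
  {γ | γ ∈ H.root ∧ (rootSpace H γ).toSubmodule ≤ (generated k H β).toSubmodule}

lemma rootSpace_le_generated (β : Weight ℂ H g) :
    (rootSpace H β).toSubmodule ≤ (generated k H β).toSubmodule :=
  LieSubmodule.subset_lieSpan

lemma mem_component_self {β : Weight ℂ H g} (hβ : β ∈ H.root) : β ∈ component k β :=
  ⟨hβ, rootSpace_le_generated β⟩

lemma generated_le_of_le {β : Weight ℂ H g} {N : LieSubmodule ℂ k g}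
    (h : (rootSpace H β).toSubmodule ≤ N.toSubmodule) : generated k H β ≤ N :=
  LieSubmodule.lieSpan_le.mpr h

lemma generated_ne_bot (β : Weight ℂ H g) : generated k H β ≠ ⊥ := by
  intro h
  obtain ⟨e, he, h0⟩ := β.exists_ne_zero
  have : e ∈ generated k H β := rootSpace_le_generated β he
  rw [h] at this
  exact h0 (by simpa using this)

lemma rootSpace_le_or_le_of_isCompl (hH : H ≤ k) {β : Weight ℂ H g} (hβ : β ∈ H.root)
    {N N' : LieSubmodule ℂ k g} (hc : IsCompl N N') :
    (rootSpace H β).toSubmodule ≤ N.toSubmodule ∨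
      (rootSpace H β).toSubmodule ≤ N'.toSubmodule :=
  rootSpace_le_or_le hβ (LieSubmodule.isCompl_toSubmodule.mpr hc)
    (fun h _ hx ↦ N.lie_mem (x := ⟨h, hH h.2⟩) hx)
    (fun h _ hx ↦ N'.lie_mem (x := ⟨h, hH h.2⟩) hx)

namespace IsPair

variable (hk : IsPair k θ) (hH : H ≤ k)
include hk hH

/-- Given a proper submodule N and a complement N', the root space of β lies in one of them. It
cannot lie in N, which is proper, so the generated module lies in N' and N is zero. -/
lemma isAtom_generated {β : Weight ℂ H g} (hβ : β ∈ H.root) : IsAtom (generated k H β) := by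
  refine ⟨generated_ne_bot β, fun N hN ↦ ?_⟩
  have := hk.reductive
  obtain ⟨N', hc⟩ := exists_isCompl N
  rcases rootSpace_le_or_le_of_isCompl hH hβ hc with h | h
  · exact absurd (generated_le_of_le h) (not_le_of_gt hN)
  · exact le_bot_iff.mp (hc.disjoint le_rfl (hN.le.trans (generated_le_of_le h)))

lemma generated_eq {β γ : Weight ℂ H g} (hβ : β ∈ H.root) (h : γ ∈ component k β) :
    generated k H γ = generated k H β :=
  ((hk.isAtom_generated hH hβ).le_iff.mp (generated_le_of_le h.2)).resolve_left
    (generated_ne_bot γ)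

lemma component_eq {β γ : Weight ℂ H g} (hβ : β ∈ H.root) (h : γ ∈ component k β) :
    component k γ = component k β := by
  rw [component, component, hk.generated_eq hH hβ h]

lemma kstable_noncompact : KStable k θ {α : Weight ℂ H g | IsNoncompactRoot θ H α} where
  noncompact _ h := h
  add_mem β hβ α hα γ hγ hs := hk.compact_add_noncompact hα hβ hγ (by rw [hs, add_comm])

lemma component_subset {S : Set (Weight ℂ H g)} (hS : KStable k θ S) {β : Weight ℂ H g}
    (hβ : β ∈ S) : component k β ⊆ S :=
  fun _ h ↦ rootSpace_le_rootSpan_iff.mp (h.2.trans (hS.generated_le hk hH hβ))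

lemma kstable_component {β : Weight ℂ H g} (hβ : IsNoncompactRoot θ H β) :
    KStable k θ (component k β) where
  noncompact := hk.component_subset hH (hk.kstable_noncompact hH) hβ
  add_mem γ hγ α hα δ hδ hs := by
    refine ⟨hδ, rootSpace_le_of_lie_mem hα.1 hδ (hs.trans (add_comm _ _)) fun x hx y hy ↦ ?_⟩
    exact (generated k H β).lie_mem (x := ⟨x, hα.2 hx⟩) (hγ.2 hy)

lemma generated_eq_rootSpan {β : Weight ℂ H g} (hβ : IsNoncompactRoot θ H β) :
    (generated k H β).toSubmodule = rootSpan H (component k β) :=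
  le_antisymm ((hk.kstable_component hH hβ).generated_le hk hH (mem_component_self hβ.1))
    (iSup₂_le fun _ h ↦ h.2)

lemma component_neg {β : Weight ℂ H g} (hβ : IsNoncompactRoot θ H β) :
    component k (-β) = negSet H (component k β) := by
  have key : ∀ β : Weight ℂ H g, IsNoncompactRoot θ H β →
      component k (-β) ⊆ negSet H (component k β) := fun β hβ ↦
    hk.component_subset hH ((hk.kstable_component hH hβ).negSet hk hH)
      (show -(-β) ∈ component k β by rw [neg_neg]; exact mem_component_self hβ.1)
  refine (key β hβ).antisymm fun γ hγ ↦ ?_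
  have h1 : -γ ∈ component k (- -β) := by rw [neg_neg]; exact hγ
  have h2 : - -γ ∈ component k (-β) := key (-β) (hk.noncompact_neg hH hβ) h1
  rwa [neg_neg] at h2

/-- The generated module is the smallest `ad k`-stable space to test, and it is the span of the root
spaces of its component. -/
lemma isTotallyPositive_iff {P : Set (Weight ℂ H g)} {β : Weight ℂ H g} :
    IsTotallyPositive k θ H P β ↔ IsNoncompactRoot θ H β ∧ component k β ⊆ P := by
  constructor
  · rintro ⟨hβ, m, hm, hβm⟩
    have h1 : component k β ⊆ noncompactPart θ H P := fun γ hγ ↦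
      rootSpace_le_rootSpan_iff.mp (hγ.2.trans (LE.le.trans (generated_le_of_le hβm) hm))
    exact ⟨(h1 (mem_component_self hβ)).2, fun γ hγ ↦ (h1 hγ).1⟩
  · rintro ⟨hβ, h⟩
    refine ⟨hβ.1, generated k H β, ?_, rootSpace_le_generated β⟩
    rw [hk.generated_eq_rootSpan hH hβ]
    exact rootSpan_mono fun γ hγ ↦ ⟨h hγ, (hk.kstable_component hH hβ).noncompact γ hγ⟩

lemma kstable_totallyPositive (P : Set (Weight ℂ H g)) :
    KStable k θ (totallyPositiveRoots k θ H P) where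
  noncompact β hβ := ((hk.isTotallyPositive_iff hH).mp hβ).1
  add_mem β hβ α hα γ hγ hs := by
    obtain ⟨h1, h2⟩ := (hk.isTotallyPositive_iff hH).mp hβ
    have h3 : γ ∈ component k β := (hk.kstable_component hH h1).add_mem β
      (mem_component_self h1.1) α hα γ hγ hs
    refine (hk.isTotallyPositive_iff hH).mpr
      ⟨(hk.kstable_component hH h1).noncompact γ h3, ?_⟩
    rwa [hk.component_eq hH h1.1 h3]

lemma totallyPositive_subset {P : Set (Weight ℂ H g)} :
    totallyPositiveRoots k θ H P ⊆ noncompactPart θ H P := fun _ hβ ↦ by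
  obtain ⟨h1, h2⟩ := (hk.isTotallyPositive_iff hH).mp hβ
  exact ⟨h2 (mem_component_self h1.1), h1⟩

/-- If the sum of two non-compact roots is a root, the negative of the second one lies in every
`k`-stable set which contains the first one. -/
lemma neg_mem_of_add {S : Set (Weight ℂ H g)} (hS : KStable k θ S) {β γ δ : Weight ℂ H g}
    (hβ : β ∈ S) (hγ : IsNoncompactRoot θ H γ) (hδ : δ ∈ H.root)
    (h : Weight.toLinear ℂ H g δ = Weight.toLinear ℂ H g β + Weight.toLinear ℂ H g γ) :
    -γ ∈ S := by
  -- δ = β + γ is compact, so -γ = β + (-δ) is reached from β by adding a compact root.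
  have h1 := hk.compact_neg hH (hk.noncompact_add (hS.noncompact β hβ) hγ hδ h)
  refine hS.add_mem β hβ (-δ) h1 (-γ) (neg_mem_root hγ.1) ?_
  rw [Weight.toLinear_neg, Weight.toLinear_neg, h]; abel

lemma add_notMem_root {P : Set (Weight ℂ H g)} (hP : IsPositiveSystem H P)
    {S : Set (Weight ℂ H g)} (hS : KStable k θ S) (hSP : S ⊆ P)
    {β γ δ : Weight ℂ H g} (hβ : β ∈ S) (hγ : γ ∈ S) (hδ : δ ∈ H.root)
    (h : Weight.toLinear ℂ H g δ = Weight.toLinear ℂ H g β + Weight.toLinear ℂ H g γ) : False :=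
  hP.neg_notMem γ (hSP hγ) (hSP (hk.neg_mem_of_add hH hS hβ (hS.noncompact γ hγ) hδ h))

end IsPair
end Components

/-! ### Averaging over a reflection-stable set of roots. -/

section RootPairing

variable {ι R M N : Type*} [Finite ι] [CommRing R] [IsDomain R] [CharZero R] [AddCommGroup M]
  [Module R M] [AddCommGroup N] [Module R N] (Q : RootPairing ι R M N) [Q.IsCrystallographic]

/-- Let `C` be a set of roots with pairwise non-negative pairings which is stable under the
reflections in the roots of `K`. A root congruent to an element of `C` modulo the span of `K`
does not belong to `K`, and has positive pairing with some element of `C`. -/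
lemma exists_pairingIn_pos (K : Set ι) (C : Finset ι)
    (hC : ∀ i ∈ C, ∀ j ∈ C, 0 ≤ Q.pairingIn ℤ i j)
    (hKC : ∀ a ∈ K, ∀ i ∈ C, Q.reflectionPerm a i ∈ C)
    {i j : ι} (hi : i ∈ C)
    (hij : Q.root j - Q.root i ∈ Submodule.span ℤ (Q.root '' K)) :
    j ∉ K ∧ ∃ m ∈ C, 0 < Q.pairingIn ℤ m j := by
  have : Fintype ι := Fintype.ofFinite ι
  -- A positive invariant form with integral values on roots; pairings have the sign of `b` since
  -- the second argument has positive length.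
  set B := Q.posRootForm ℤ
  let b : ι → ι → ℤ := fun i j ↦ B.posForm (Q.rootSpanMem ℤ i) (Q.rootSpanMem ℤ j)
  have hb : ∀ i j, (b i j : R) = B.form (Q.root i) (Q.root j) := fun i j ↦
    B.algebraMap_posForm
  have h2 : ∀ i j, 2 * b i j = Q.pairingIn ℤ i j * b j j := by
    intro i j
    have h3 : ((2 * b i j : ℤ) : R) = ((Q.pairingIn ℤ i j * b j j : ℤ) : R) := by
      push_cast
      rw [hb, hb, B.two_mul_apply_root_root]
      congr 1
      exact (Q.algebraMap_pairingIn ℤ i j).symm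
    exact_mod_cast h3
  have hpos : ∀ i, 0 < b i i := fun i ↦ B.zero_lt_posForm_apply_root i
  -- The reflection in a permutes `C` and changes the sign of the pairing with a, so the total over
  -- `C` equals its own negative.
  have hK : ∀ a ∈ K, ∑ m ∈ C, b m a = 0 := by
    intro a ha
    have hbij : ∑ m ∈ C, Q.pairingIn ℤ (Q.reflectionPerm a m) a = ∑ m ∈ C, Q.pairingIn ℤ m a :=
      Finset.sum_nbij' (Q.reflectionPerm a) (Q.reflectionPerm a) (hKC a ha) (hKC a ha)
        (by simp) (by simp) (by simp)
    have hneg : ∀ m, Q.pairingIn ℤ (Q.reflectionPerm a m) a = - Q.pairingIn ℤ m a := by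
      intro m
      have : ((Q.pairingIn ℤ (Q.reflectionPerm a m) a : ℤ) : R) =
          ((- Q.pairingIn ℤ m a : ℤ) : R) := by
        push_cast
        have e1 := Q.algebraMap_pairingIn ℤ (Q.reflectionPerm a m) a
        have e2 := Q.algebraMap_pairingIn ℤ m a
        simp only [algebraMap_int_eq, eq_intCast] at e1 e2
        rw [e1, e2]
        rw [← Q.pairing_reflectionPerm, Q.pairing_reflectionPerm_self_right]
      exact_mod_cast this
    simp only [hneg, Finset.sum_neg_distrib] at hbij
    have h0 : ∑ m ∈ C, Q.pairingIn ℤ m a = 0 := by omega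
    have : 2 * ∑ m ∈ C, b m a = 0 := by
      rw [Finset.mul_sum, Finset.sum_congr rfl fun m _ ↦ h2 m a, ← Finset.sum_mul, h0, zero_mul]
    omega
  let F : M →ₗ[ℤ] R := (∑ m ∈ C, B.form (Q.root m)).restrictScalars ℤ
  have hF : ∀ j, F (Q.root j) = ((∑ m ∈ C, b m j : ℤ) : R) := by
    intro j
    simp [F, hb]
  have hsp : Submodule.span ℤ (Q.root '' K) ≤ LinearMap.ker F := by
    rw [Submodule.span_le]
    rintro _ ⟨a, ha, rfl⟩
    change F (Q.root a) = 0
    rw [hF, hK a ha, Int.cast_zero]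
  have hFij : F (Q.root j) = F (Q.root i) := by
    have := hsp hij
    rwa [LinearMap.mem_ker, map_sub, sub_eq_zero] at this
  rw [hF, hF] at hFij
  -- The form against the sum of `C` vanishes on the span of `K`, so it takes the same value at i
  -- and j; at i it is at least `b i i`, as all other terms are non-negative.
  have hs : ∑ m ∈ C, b m j = ∑ m ∈ C, b m i := by exact_mod_cast hFij
  have hle : b i i ≤ ∑ m ∈ C, b m i := by
    refine Finset.single_le_sum (f := fun m ↦ b m i) (fun m hm ↦ ?_) hi
    have := h2 m i
    have := mul_nonneg (hC m hm i hi) (hpos i).le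
    change 0 ≤ b m i
    omega
  have hsum : 0 < ∑ m ∈ C, b m j := by
    rw [hs]
    exact (hpos i).trans_le hle
  refine ⟨fun hj ↦ ?_, ?_⟩
  · rw [hK j hj] at hsum
    exact lt_irrefl _ hsum
  · obtain ⟨m, hm, hmj⟩ := Finset.exists_lt_of_sum_lt
      (s := C) (f := fun _ ↦ (0 : ℤ)) (g := fun m ↦ b m j) (by simpa using hsum)
    refine ⟨m, hm, ?_⟩
    have := h2 m j
    by_contra hcon
    have := mul_nonpos_of_nonpos_of_nonneg (not_lt.mp hcon) (hpos j).le
    change 0 < b m j at hmj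
    omega

end RootPairing

/-! ### Strings of compact roots and parts (a), (b). -/

section Strings

variable {H : LieSubalgebra ℂ g} [H.IsCartanSubalgebra]
variable {k : LieSubalgebra ℂ g} {θ : g ≃ₗ⁅ℂ⁆ g}

/-- Root strings are unbroken, so δ can be reached from β one compact root at a time. No
intermediate weight is zero: otherwise β would be a multiple of α, hence ±α, hence compact. -/
lemma KStable.mem_of_eq_add_nsmul (hk : IsPair k θ) {S : Set (Weight ℂ H g)}
    (hS : KStable k θ S) (hH : H ≤ k) {α β : Weight ℂ H g} (hα : IsCompactRoot k H α)
    (hβ : β ∈ S) (n : ℕ) {δ : Weight ℂ H g} (hδ : δ ∈ H.root)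
    (h : Weight.toLinear ℂ H g δ = Weight.toLinear ℂ H g β + n • Weight.toLinear ℂ H g α) :
    δ ∈ S := by
  induction n generalizing δ with
  | zero =>
    rw [zero_smul, add_zero] at h
    rwa [weight_ext h]
  | succ n ih =>
    have hα0 := isNonZero_of_mem hα.1
    have h1 := (IsKilling.rootSpace_zsmul_add_ne_bot_iff α β hα0 (n + 1)).mp (by
      have h2 : (δ : H → ℂ) = ((n : ℤ) + 1) • (α : H → ℂ) + β := by
        ext z
        have := LinearMap.congr_fun h z
        simp only [Weight.toLinear_apply, LinearMap.add_apply, LinearMap.smul_apply] at this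
        rw [this, Pi.add_apply, Pi.smul_apply, add_comm]
        congr 1
      rw [← h2]
      exact δ.genWeightSpace_ne_bot)
    have h2 := (IsKilling.rootSpace_zsmul_add_ne_bot_iff α β hα0 n).mpr (by omega)
    let ε : Weight ℂ H g := ⟨_, h2⟩
    have hε : Weight.toLinear ℂ H g ε =
        Weight.toLinear ℂ H g β + n • Weight.toLinear ℂ H g α := by
      ext z
      change (((n : ℤ) • (α : H → ℂ) + β : H → ℂ)) z = _
      simp [add_comm]
    have hεr : ε ∈ H.root := by
      by_contra hcon
      have hz : ε.IsZero := by simpa using hcon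
      rw [Weight.coe_toLinear_eq_zero_iff.mpr hz] at hε
      have h3 : (β : H → ℂ) = (-n : ℂ) • (α : H → ℂ) := by
        ext z
        have := LinearMap.congr_fun hε z
        simp only [LinearMap.zero_apply, LinearMap.add_apply, LinearMap.smul_apply,
          Weight.toLinear_apply, nsmul_eq_mul] at this
        rw [Pi.smul_apply, smul_eq_mul, neg_mul]
        exact eq_neg_of_add_eq_zero_left this.symm
      have hβn := hS.noncompact β hβ
      rcases IsKilling.eq_neg_or_eq_of_eq_smul α β (isNonZero_of_mem hβn.1) _ h3 with h4 | h4
      · exact hk.not_compact hβn (h4 ▸ hk.compact_neg hH hα)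
      · exact hk.not_compact hβn (h4 ▸ hα)
    refine hS.add_mem ε (ih hεr hε) α hα δ hδ ?_
    rw [hε, h, succ_nsmul, add_assoc]

lemma KStable.mem_of_eq_add_zsmul (hk : IsPair k θ) {S : Set (Weight ℂ H g)}
    (hS : KStable k θ S) (hH : H ≤ k) {α β : Weight ℂ H g} (hα : IsCompactRoot k H α)
    (hβ : β ∈ S) (n : ℤ) {δ : Weight ℂ H g} (hδ : δ ∈ H.root)
    (h : Weight.toLinear ℂ H g δ = Weight.toLinear ℂ H g β + n • Weight.toLinear ℂ H g α) :
    δ ∈ S := by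
  rcases n.eq_nat_or_neg with ⟨m, rfl | rfl⟩
  · exact hS.mem_of_eq_add_nsmul hk hH hα hβ m hδ (by simpa using h)
  · exact hS.mem_of_eq_add_nsmul hk hH (hk.compact_neg hH hα) hβ m hδ (by simpa using h)

lemma pairingIn_cast (i j : H.root) :
    (((IsKilling.rootSystem H).pairingIn ℤ i j : ℤ) : ℂ) = i.1 (IsKilling.coroot j.1) :=
  (IsKilling.rootSystem H).algebraMap_pairingIn ℤ i j

lemma pairingIn_add_zsmul {i j a : H.root} {n : ℤ}
    (h : Weight.toLinear ℂ H g i = Weight.toLinear ℂ H g j + n • Weight.toLinear ℂ H g a)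
    (m : H.root) :
    (IsKilling.rootSystem H).pairingIn ℤ i m = (IsKilling.rootSystem H).pairingIn ℤ j m +
      n * (IsKilling.rootSystem H).pairingIn ℤ a m := by
  have h1 := LinearMap.congr_fun h (IsKilling.coroot m.1)
  simp only [LinearMap.add_apply, LinearMap.smul_apply, Weight.toLinear_apply, zsmul_eq_mul] at h1
  rw [← pairingIn_cast, ← pairingIn_cast, ← pairingIn_cast] at h1
  exact_mod_cast h1

lemma exists_root_of_mem_range {f : Module.Dual ℂ H}
    (h : f ∈ Set.range (IsKilling.rootSystem H).root) :
    ∃ γ ∈ H.root, Weight.toLinear ℂ H g γ = f := by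
  obtain ⟨i, hi⟩ := h
  exact ⟨i.1, i.2, hi⟩

namespace IsPair

variable (hk : IsPair k θ) (hH : H ≤ k)
include hk hH

/-- Two roots that are not opposite and have negative pairing add up to a root, which is impossible
inside a `k`-stable subset of `P`. -/
lemma pairingIn_nonneg {P : Set (Weight ℂ H g)} (hP : IsPositiveSystem H P)
    {S : Set (Weight ℂ H g)} (hS : KStable k θ S) (hSP : S ⊆ P) {i j : H.root}
    (hi : i.1 ∈ S) (hj : j.1 ∈ S) : 0 ≤ (IsKilling.rootSystem H).pairingIn ℤ i j := by
  by_contra hcon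
  have hne : (IsKilling.rootSystem H).root i ≠ -(IsKilling.rootSystem H).root j := by
    intro h
    have h1 : i.1 = -j.1 := weight_ext (by rw [Weight.toLinear_neg]; exact h)
    exact hP.neg_notMem _ (hSP hj) (h1 ▸ hSP hi)
  obtain ⟨δ, hδ, h⟩ := exists_root_of_mem_range
    ((IsKilling.rootSystem H).root_add_root_mem_of_pairingIn_neg (not_le.mp hcon) hne)
  exact hk.add_notMem_root hH hP hS hSP hi hj hδ h

lemma mem_component_of_sub_mem_span {P : Set (Weight ℂ H g)} (hP : IsPositiveSystem H P)
    {β : Weight ℂ H g} (hβ : IsTotallyPositive k θ H P β) {γ : Weight ℂ H g} (hγ : γ ∈ H.root)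
    (h : Weight.toLinear ℂ H g γ - Weight.toLinear ℂ H g β ∈
      Submodule.span ℤ {l | ∃ α, IsCompactRoot k H α ∧ Weight.toLinear ℂ H g α = l}) :
    γ ∈ component k β := by
  obtain ⟨hβn, hβP⟩ := (hk.isTotallyPositive_iff hH).mp hβ
  have hS := hk.kstable_component hH hβn
  set Q := IsKilling.rootSystem H
  have hset : {l | ∃ α, IsCompactRoot k H α ∧ Weight.toLinear ℂ H g α = l} =
      Q.root '' {i | IsCompactRoot k H i.1} := by
    ext l
    constructor
    · rintro ⟨α, hα, rfl⟩
      exact ⟨⟨α, hα.1⟩, hα, rfl⟩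
    · rintro ⟨i, hi, rfl⟩
      exact ⟨i.1, hi, rfl⟩
  rw [hset] at h
  classical
  let C : Finset H.root := Finset.univ.filter fun i ↦ i.1 ∈ component k β
  have hCmem : ∀ i : H.root, i ∈ C ↔ i.1 ∈ component k β := fun i ↦ by simp [C]
  obtain ⟨hγc, m, hm, hpos⟩ := exists_pairingIn_pos Q {i | IsCompactRoot k H i.1} C
    (fun i hi j hj ↦ hk.pairingIn_nonneg hH hP hS hβP ((hCmem i).mp hi) ((hCmem j).mp hj))
    (fun a ha i hi ↦ (hCmem _).mpr <|
      hS.mem_of_eq_add_zsmul hk hH (α := a.1) (β := i.1) ha ((hCmem i).mp hi)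
        (-Q.pairingIn ℤ i a) (Q.reflectionPerm a i).2 <| by
        have h1 : Q.root (Q.reflectionPerm a i) = Q.root i - Q.pairing i a • Q.root a := by
          rw [Q.root_reflectionPerm, Q.reflection_apply_root]
        have h2 : Q.pairing i a = ((Q.pairingIn ℤ i a : ℤ) : ℂ) :=
          (Q.algebraMap_pairingIn ℤ i a).symm
        rw [h2, Int.cast_smul_eq_zsmul] at h1
        rw [neg_smul, ← sub_eq_add_neg]
        exact h1)
    (i := ⟨β, hβ.1⟩) (j := ⟨γ, hγ⟩) ((hCmem _).mpr (mem_component_self hβ.1)) h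
  have hγn := (hk.compact_or_noncompact hH hγ).resolve_left hγc
  by_cases hmγ : m = ⟨γ, hγ⟩
  · have := (hCmem m).mp hm
    rwa [hmγ] at this
  -- m and γ are distinct with positive pairing, so m + (-γ) is a root, and `neg_mem_of_add` applied
  -- to -γ returns γ.
  obtain ⟨δ, hδ, hs⟩ := exists_root_of_mem_range (Q.root_sub_root_mem_of_pairingIn_pos hpos hmγ)
  have hs' : Weight.toLinear ℂ H g δ = Weight.toLinear ℂ H g m.1 + Weight.toLinear ℂ H g (-γ) := by
    rw [hs, Weight.toLinear_neg, ← sub_eq_add_neg]; rfl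
  have := hk.neg_mem_of_add hH hS ((hCmem m).mp hm) (hk.noncompact_neg hH hγn) hδ hs'
  rwa [neg_neg] at this

lemma sub_le_two {P : Set (Weight ℂ H g)} (hP : IsPositiveSystem H P)
    {S : Set (Weight ℂ H g)} (hS : KStable k θ S) (hSP : S ⊆ P) {α β γ : Weight ℂ H g}
    (hα : IsCompactRoot k H α) (hβ : β ∈ S) (hγ : γ ∈ S) {n : ℤ}
    (h : Weight.toLinear ℂ H g γ = Weight.toLinear ℂ H g β + n • Weight.toLinear ℂ H g α) :
    n ≤ 2 := by
  by_contra hn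
  let a : H.root := ⟨α, hα.1⟩
  let b : H.root := ⟨β, (hS.noncompact β hβ).1⟩
  let c : H.root := ⟨γ, (hS.noncompact γ hγ).1⟩
  set Q := IsKilling.rootSystem H
  have h1 : Q.pairingIn ℤ c a = Q.pairingIn ℤ b a + n * Q.pairingIn ℤ a a :=
    pairingIn_add_zsmul (i := c) (j := b) (a := a) h a
  have h2 : Q.pairingIn ℤ c b = Q.pairingIn ℤ b b + n * Q.pairingIn ℤ a b :=
    pairingIn_add_zsmul (i := c) (j := b) (a := a) h b
  have h3 : 0 ≤ Q.pairingIn ℤ c b := hk.pairingIn_nonneg hH hP hS hSP hγ hβ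
  rw [Q.pairingIn_same] at h1 h2
  -- Cartan integers lie between -3 and 3, while those of c and b against a differ by 2n ≥ 6. Hence
  -- n = 3 and the pairing of b with a is -3, so that of a with b is -1, and the pairing of c with b
  -- is 2 - 3 < 0.
  have h4 := Q.pairingIn_pairingIn_mem_set_of_isCrystal_of_isRed b a
  have h5 := Q.pairingIn_pairingIn_mem_set_of_isCrystal_of_isRed c a
  simp only [Set.mem_insert_iff, Set.mem_singleton_iff, Prod.mk.injEq] at h4 h5
  have h6 : Q.pairingIn ℤ c a ≤ 3 := by omega
  have h7 : Q.pairingIn ℤ b a = -3 ∧ n = 3 := by omega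
  have h8 : Q.pairingIn ℤ a b = -1 := by omega
  rw [h8, h7.2] at h2
  omega

lemma encard_string_le {P : Set (Weight ℂ H g)} (hP : IsPositiveSystem H P)
    {α γ : Weight ℂ H g} (hγ : IsTotallyPositive k θ H P γ) (hα : IsCompactRoot k H α) :
    {δ : Weight ℂ H g | δ ∈ H.root ∧ ∃ n : ℤ, Weight.toLinear ℂ H g δ =
      Weight.toLinear ℂ H g γ + n • Weight.toLinear ℂ H g α}.encard ≤ 3 := by
  obtain ⟨hγn, hγP⟩ := (hk.isTotallyPositive_iff hH).mp hγ
  have hS := hk.kstable_component hH hγn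
  set D := {δ : Weight ℂ H g | δ ∈ H.root ∧ ∃ n : ℤ, Weight.toLinear ℂ H g δ =
      Weight.toLinear ℂ H g γ + n • Weight.toLinear ℂ H g α}
  have hD : ∀ δ : D, ∃ n : ℤ, Weight.toLinear ℂ H g δ.1 =
      Weight.toLinear ℂ H g γ + n • Weight.toLinear ℂ H g α := fun δ ↦ δ.2.2
  choose f hf using hD
  have hDS : ∀ δ : D, δ.1 ∈ component k γ := fun δ ↦
    hS.mem_of_eq_add_zsmul hk hH hα (mem_component_self hγ.1) (f δ) δ.2.1 (hf δ)
  have hinj : Function.Injective f := fun δ δ' h ↦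
    Subtype.ext (weight_ext (by rw [hf, hf, h]))
  -- Any two exponents differ by at most 2, so all of them lie in an interval of three integers.
  have hle : ∀ δ δ' : D, f δ ≤ f δ' + 2 := by
    intro δ δ'
    have := hk.sub_le_two hH hP hS hγP hα (hDS δ') (hDS δ) (n := f δ - f δ')
      (by rw [hf, hf, sub_smul]; abel)
    omega
  have : Nonempty D := ⟨⟨γ, hγ.1, 0, by simp⟩⟩
  obtain ⟨δ₀, h0⟩ := Finite.exists_min f
  have hmaps : Set.range f ⊆ (Finset.Icc (f δ₀) (f δ₀ + 2) : Finset ℤ) := by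
    rintro _ ⟨δ, rfl⟩
    simpa using ⟨h0 δ, hle δ δ₀⟩
  have h1 : (Set.range f).encard = D.encard := by
    rw [← Set.image_univ, hinj.encard_image, Set.encard_univ]
    rfl
  rw [← h1]
  refine (Set.encard_le_encard hmaps).trans ?_
  rw [Set.encard_coe_eq_coe_finsetCard, Int.card_Icc]
  have : (f δ₀ + 2 + 1 - f δ₀).toNat = 3 := by omega
  rw [this]
  norm_num

end IsPair
end Strings

/-! ### The ideal [m, m] + m attached to a symmetric `k`-stable set, and part (c). -/

section Ideals

variable {H : LieSubalgebra ℂ g} [H.IsCartanSubalgebra]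
variable {k : LieSubalgebra ℂ g} {θ : g ≃ₗ⁅ℂ⁆ g}

/-- The subspace `[m, m] + m`. -/
def bracketSup (m : Submodule ℂ g) : Submodule ℂ g :=
  Submodule.span ℂ {z | ∃ x ∈ m, ∃ y ∈ m, ⁅x, y⁆ = z} ⊔ m

lemma bracketSup_le {m : Submodule ℂ g} {I : LieIdeal ℂ g} (h : m ≤ I.toSubmodule) :
    bracketSup m ≤ I.toSubmodule := by
  refine sup_le (Submodule.span_le.mpr ?_) h
  rintro _ ⟨x, _, y, hy, rfl⟩
  exact I.lie_mem (h hy)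

lemma lie_mem_bracketSup {m : Submodule ℂ g} {x y : g} (hx : x ∈ m) (hy : y ∈ m) :
    ⁅x, y⁆ ∈ bracketSup m :=
  Submodule.mem_sup_left (Submodule.subset_span ⟨x, hx, y, hy, rfl⟩)

namespace KStable

variable {S : Set (Weight ℂ H g)} (hS : KStable k θ S) (hk : IsPair k θ) (hH : H ≤ k)
  (hsym : ∀ β ∈ S, -β ∈ S)

include hS hk in
lemma span_brackets_le :
    Submodule.span ℂ {z | ∃ x ∈ rootSpan H S, ∃ y ∈ rootSpan H S, ⁅x, y⁆ = z} ≤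
      k.toSubmodule := by
  have hle : rootSpan H S ≤ pSpace θ := iSup₂_le fun β hβ ↦ (hS.noncompact β hβ).2
  rw [Submodule.span_le]
  rintro _ ⟨x, hx, y, hy, rfl⟩
  exact hk.lie_mem_k (hle hx) (hle hy)

include hS hk hH hsym in
-- For α outside `S` and β in it, a root α + β would force -α, hence by symmetry α, into `S`; and α
-- = -β is excluded by symmetry too.
lemma lie_eq_zero {x y : g}
    (hx : x ∈ rootSpan H {α | IsNoncompactRoot θ H α ∧ α ∉ S}) (hy : y ∈ rootSpan H S) :
    ⁅x, y⁆ = 0 := by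
  have : ⁅x, y⁆ ∈ (⊥ : Submodule ℂ g) := by
    refine lie_mem_of_forall ?_ hx hy
    rintro α ⟨hα, hαS⟩ u hu β hβ v hv
    by_contra h0
    obtain ⟨γ, hγ⟩ := exists_weight_of_lie_ne_zero hu hv h0
    apply hαS
    by_cases hγr : γ ∈ H.root
    · have := hsym _ (hk.neg_mem_of_add hH hS hβ hα hγr (by rw [hγ, add_comm]))
      rwa [neg_neg] at this
    · have hz : γ.IsZero := by simpa using hγr
      rw [Weight.coe_toLinear_eq_zero_iff.mpr hz] at hγ
      have : α = -β := weight_ext (by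
        rw [Weight.toLinear_neg]; exact eq_neg_of_add_eq_zero_left hγ.symm)
      exact this ▸ hsym β hβ
  exact this

include hS hk hH hsym in
-- g is the sum of `k`, m and the span of the remaining non-compact root spaces: `k` preserves m,
-- [m, [m, m]] ⊆ [m, k] ⊆ m, and the remaining part commutes with m.
lemma lie_mem_bracketSup {x z : g} (hz : z ∈ bracketSup (rootSpan H S)) :
    ⁅x, z⁆ ∈ bracketSup (rootSpan H S) := by
  set J := bracketSup (rootSpan H S)
  have hMJ : rootSpan H S ≤ J := le_sup_right
  have reduce : ∀ x : g, (∀ y ∈ rootSpan H S, ⁅x, y⁆ ∈ J) →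
      (∀ y ∈ rootSpan H S, ∀ z ∈ rootSpan H S, ⁅x, ⁅y, z⁆⁆ ∈ J) → ∀ z ∈ J, ⁅x, z⁆ ∈ J := by
    intro x h1 h2
    have : J ≤ J.comap (ad ℂ g x : g →ₗ[ℂ] g) := by
      refine sup_le (Submodule.span_le.mpr ?_) h1
      rintro _ ⟨y, hy, z, hz, rfl⟩
      exact h2 y hy z hz
    exact this
  have hkJ : ∀ x ∈ k, ∀ z ∈ J, ⁅x, z⁆ ∈ J := by
    intro x hx
    refine reduce x (fun y hy ↦ hMJ (hS.lie_mem hk hH hx hy)) fun y hy z hz ↦ ?_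
    rw [leibniz_lie]
    exact J.add_mem (HarishChandra.lie_mem_bracketSup (hS.lie_mem hk hH hx hy) hz)
      (HarishChandra.lie_mem_bracketSup hy (hS.lie_mem hk hH hx hz))
  have hMM : ∀ x ∈ rootSpan H S, ∀ z ∈ J, ⁅x, z⁆ ∈ J := by
    intro x hx
    refine reduce x (fun y hy ↦ HarishChandra.lie_mem_bracketSup hx hy) fun y hy z hz ↦ ?_
    rw [← lie_skew]
    refine J.neg_mem (hMJ (hS.lie_mem hk hH ?_ hx))
    exact hS.span_brackets_le hk (Submodule.subset_span ⟨y, hy, z, hz, rfl⟩)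
  have hpJ : ∀ x ∈ rootSpan H {α | IsNoncompactRoot θ H α ∧ α ∉ S}, ∀ z ∈ J, ⁅x, z⁆ ∈ J := by
    intro x hx
    refine reduce x (fun y hy ↦ ?_) fun y hy z hz ↦ ?_
    · rw [hS.lie_eq_zero hk hH hsym hx hy]; exact J.zero_mem
    · rw [leibniz_lie, hS.lie_eq_zero hk hH hsym hx hy, hS.lie_eq_zero hk hH hsym hx hz]
      simp
  have hle : rootSpan H {α | IsNoncompactRoot θ H α} ≤
      rootSpan H S ⊔ rootSpan H {α | IsNoncompactRoot θ H α ∧ α ∉ S} := by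
    refine iSup₂_le fun α hα ↦ ?_
    by_cases h : α ∈ S
    · exact le_sup_of_le_left (rootSpace_le_rootSpan h)
    · exact le_sup_of_le_right (rootSpace_le_rootSpan ⟨hα, h⟩)
  have htop : x ∈ k.toSubmodule ⊔ rootSpan H {α | IsNoncompactRoot θ H α} := by
    rw [hk.k_eq hH, hk.sup_eq_top hH]; trivial
  obtain ⟨a, ha, b, hb, rfl⟩ := Submodule.mem_sup.mp htop
  obtain ⟨c, hc, d, hd, rfl⟩ := Submodule.mem_sup.mp (hle hb)
  rw [add_lie, add_lie]
  exact J.add_mem (hkJ a ha z hz) (J.add_mem (hMM c hc z hz) (hpJ d hd z hz))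

/-- The ideal `[m, m] + m`, where `m` is spanned by the root spaces of a symmetric `k`-stable set
of roots. -/
def ideal : LieIdeal ℂ g where
  __ := bracketSup (rootSpan H S)
  lie_mem hm := hS.lie_mem_bracketSup hk hH hsym hm

lemma rootSpace_le_ideal {β : Weight ℂ H g} (hβ : β ∈ S) :
    (rootSpace H β).toSubmodule ≤ (hS.ideal hk hH hsym).toSubmodule :=
  (rootSpace_le_rootSpan hβ).trans le_sup_right

/-- [m, m] lies in `k`, so the part of the ideal inside `p` is m alone. -/
lemma mem_of_rootSpace_le_ideal {β : Weight ℂ H g} (hβ : IsNoncompactRoot θ H β)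
    (h : (rootSpace H β).toSubmodule ≤ (hS.ideal hk hH hsym).toSubmodule) : β ∈ S := by
  obtain ⟨e, he, h0⟩ := β.exists_ne_zero
  obtain ⟨a, ha, b, hb, rfl⟩ := Submodule.mem_sup.mp (h he)
  have ha' := hS.span_brackets_le hk ha
  have hbp : b ∈ pSpace θ :=
    (iSup₂_le fun β hβ ↦ (hS.noncompact β hβ).2 : rootSpan H S ≤ pSpace θ) hb
  have hap : a ∈ pSpace θ := by
    have := (pSpace θ).sub_mem (hβ.2 he) hbp
    rwa [add_sub_cancel_right] at this
  have ha0 := Submodule.disjoint_def.mp hk.disjoint a ha' hap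
  rw [ha0, zero_add] at he h0
  exact mem_of_mem_rootSpan he h0 hb

include hS hk hH hsym in
lemma mem_of_isSimple (hg : LieAlgebra.IsSimple ℂ g) (hne : S.Nonempty) {β : Weight ℂ H g}
    (hβ : IsNoncompactRoot θ H β) : β ∈ S := by
  obtain ⟨γ, hγ⟩ := hne
  apply hS.mem_of_rootSpace_le_ideal hk hH hsym hβ
  rcases hg.eq_bot_or_eq_top (hS.ideal hk hH hsym) with h | h
  · obtain ⟨e, he, h0⟩ := γ.exists_ne_zero
    have := hS.rootSpace_le_ideal hk hH hsym hγ he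
    rw [h] at this
    exact absurd (by simpa using this) h0
  · rw [h]; exact le_top

end KStable

lemma neg_mem_union_negSet {S : Set (Weight ℂ H g)} {β : Weight ℂ H g}
    (hβ : β ∈ S ∪ negSet H S) : -β ∈ S ∪ negSet H S := by
  rcases hβ with h | h
  · exact Or.inr (show - -β ∈ S by rwa [neg_neg])
  · exact Or.inl h

lemma rootSpan_union (S T : Set (Weight ℂ H g)) :
    rootSpan H (S ∪ T) = rootSpan H S ⊔ rootSpan H T := iSup_union

lemma gt_eq_bracketSup (P : Set (Weight ℂ H g)) :
    gt k θ H P = bracketSup (rootSpan H (totallyPositiveRoots k θ H P ∪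
      negSet H (totallyPositiveRoots k θ H P))) := by
  rw [rootSpan_union]; rfl

namespace IsPair

variable (hk : IsPair k θ) (hH : H ≤ k)
include hk hH

lemma totallyPositive_of_isSimple (hg : LieAlgebra.IsSimple ℂ g) {P : Set (Weight ℂ H g)}
    (hP : IsPositiveSystem H P) (hne : IsAdmissible k θ H P) {β : Weight ℂ H g}
    (hβ : β ∈ noncompactPart θ H P) : IsTotallyPositive k θ H P β := by
  have hS := hk.kstable_totallyPositive hH P
  rcases (hS.union (hS.negSet hk hH)).mem_of_isSimple hk hH
    (fun _ ↦ neg_mem_union_negSet) hg (hne.mono Set.subset_union_left) hβ.2 with h | h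
  · exact h
  · exact absurd (hk.totallyPositive_subset hH h).1 (hP.neg_notMem β hβ.1)

/-- If an irreducible N were generated by no totally positive root space, all these root spaces
would lie in a complement of N, and so would N itself. -/
lemma mem_components {P : Set (Weight ℂ H g)} {N : LieSubmodule ℂ k g} :
    N ∈ components k θ H P ↔ ∃ β, IsTotallyPositive k θ H P β ∧ generated k H β = N := by
  constructor
  · rintro ⟨hN, hle⟩
    rw [isIrreducible_iff_isAtom] at hN
    by_contra! hcon
    have := hk.reductive
    obtain ⟨N', hc⟩ := exists_isCompl N
    have h1 : ptPlus k θ H P ≤ N'.toSubmodule := by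
      refine iSup₂_le fun β hβ ↦ ?_
      refine (rootSpace_le_or_le_of_isCompl hH hβ.1 hc).resolve_left fun h ↦ ?_
      exact (hN.le_iff.mp (generated_le_of_le h)).elim (generated_ne_bot β) (hcon β hβ)
    exact hN.1 (hc.disjoint.eq_bot_of_le (hle.trans h1))
  · rintro ⟨β, hβ, rfl⟩
    refine ⟨(isIrreducible_iff_isAtom _).mpr (hk.isAtom_generated hH hβ.1), ?_⟩
    exact (hk.kstable_totallyPositive hH P).generated_le hk hH hβ

end IsPair

/-! ### Simple ideals and irreducible components. -/

section SimpleIdeals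

lemma neg_rootSpace_le_ideal {I : LieIdeal ℂ g} {β : Weight ℂ H g} (hβ : β ∈ H.root)
    (h : (rootSpace H β).toSubmodule ≤ I.toSubmodule) :
    (rootSpace H (-β : Weight ℂ H g)).toSubmodule ≤ I.toSubmodule := by
  obtain ⟨h', e, f, t, he, hf⟩ :=
    IsKilling.exists_isSl2Triple_of_weight_isNonZero (isNonZero_of_mem hβ)
  refine rootSpace_le_of_mem (neg_mem_root hβ) (e := f) (by simpa using hf) t.f_ne_zero ?_
  have h1 : h' ∈ I := by
    rw [← t.lie_e_f, ← lie_skew]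
    exact I.neg_mem (I.lie_mem (h he))
  have h2 : ⁅h', f⁆ ∈ I := by
    rw [← lie_skew]
    exact I.neg_mem (I.lie_mem h1)
  rw [t.lie_lie_smul_f ℂ] at h2
  have h3 := I.smul_mem (-(2 : ℂ)⁻¹) h2
  simpa using h3

lemma isSimple_iff_isAtom (I : LieIdeal ℂ g) : LieAlgebra.IsSimple ℂ I ↔ IsAtom I := by
  refine ⟨fun h ↦ ⟨?_, fun J hJ ↦ ?_⟩, IsSemisimple.isSimple_of_isAtom I⟩
  · rintro rfl
    exact h.non_abelian inferInstance
  · rcases h.eq_bot_or_eq_top (J.comap I.incl) with h1 | h1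
    · rw [eq_bot_iff]
      intro x hx
      have : (⟨x, hJ.le hx⟩ : I) ∈ J.comap I.incl := LieIdeal.mem_comap.mpr hx
      rw [h1, LieSubmodule.mem_bot] at this
      simpa using congrArg Subtype.val this
    · refine absurd (fun x hx ↦ ?_) (not_le_of_gt hJ)
      have : (⟨x, hx⟩ : I) ∈ J.comap I.incl := by rw [h1]; trivial
      exact LieIdeal.mem_comap.mp this

lemma rootSpace_le_or_le_ideal {β : Weight ℂ H g} (hβ : β ∈ H.root) {I J : LieIdeal ℂ g}
    (hc : IsCompl I J) : (rootSpace H β).toSubmodule ≤ I.toSubmodule ∨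
      (rootSpace H β).toSubmodule ≤ J.toSubmodule :=
  rootSpace_le_or_le hβ (LieSubmodule.isCompl_toSubmodule.mpr hc)
    (fun _ _ hx ↦ I.lie_mem hx) (fun _ _ hx ↦ J.lie_mem hx)

lemma lieSpan_generated (β : Weight ℂ H g) :
    LieSubmodule.lieSpan ℂ g (generated k H β : Set g) =
      LieSubmodule.lieSpan ℂ g (rootSpace H β : Set g) := by
  refine le_antisymm (LieSubmodule.lieSpan_le.mpr ?_)
    (LieSubmodule.lieSpan_mono (rootSpace_le_generated β))
  have h : generated k H β ≤ (LieSubmodule.lieSpan ℂ g (rootSpace H β : Set g)).restr k :=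
    generated_le_of_le LieSubmodule.subset_lieSpan
  exact h

lemma isAtom_lieSpan {β : Weight ℂ H g} (hβ : β ∈ H.root) :
    IsAtom (LieSubmodule.lieSpan ℂ g (rootSpace H β : Set g)) := by
  refine ⟨fun h ↦ ?_, fun I hI ↦ ?_⟩
  · obtain ⟨e, he, h0⟩ := β.exists_ne_zero
    have : e ∈ LieSubmodule.lieSpan ℂ g (rootSpace H β : Set g) := LieSubmodule.subset_lieSpan he
    rw [h] at this
    exact h0 (by simpa using this)
  · obtain ⟨J, hc⟩ := exists_isCompl I
    rcases rootSpace_le_or_le_ideal hβ hc with h | h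
    · exact absurd (LieSubmodule.lieSpan_le.mpr h) (not_le_of_gt hI)
    · exact hc.disjoint.eq_bot_of_le (hI.le.trans (LieSubmodule.lieSpan_le.mpr h))

/-- Sending a component to the ideal it generates is a bijection onto the minimal ideals, which are
the simple ones. -/
lemma IsPair.ncard_simple_ideals (hk : IsPair k θ) (hH : H ≤ k) {P : Set (Weight ℂ H g)}
    (hP : IsPositiveSystem H P) (htop : gt k θ H P = ⊤) :
    {I : LieIdeal ℂ g | LieAlgebra.IsSimple ℂ I}.ncard = (components k θ H P).ncard := by
  have himage : {I : LieIdeal ℂ g | LieAlgebra.IsSimple ℂ I} =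
      (fun N : LieSubmodule ℂ k g ↦ LieSubmodule.lieSpan ℂ g (N : Set g)) ''
        components k θ H P := by
    ext I
    rw [Set.mem_ofPred_eq, isSimple_iff_isAtom]
    constructor
    · intro hI
      by_contra hcon
      obtain ⟨J, hc⟩ := exists_isCompl I
      -- If I is not obtained from a component, every totally positive root space lies in the
      -- complement J; then so do their negatives and all of g_t = g, which leaves I = 0.
      have hJ : ∀ β, IsTotallyPositive k θ H P β →
          (rootSpace H β).toSubmodule ≤ J.toSubmodule := by
        intro β hβ
        refine (rootSpace_le_or_le_ideal hβ.1 hc).resolve_left fun h ↦ hcon ?_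
        refine ⟨_, (hk.mem_components hH).mpr ⟨β, hβ, rfl⟩, ?_⟩
        refine (lieSpan_generated β).trans ?_
        exact (hI.le_iff.mp (LieSubmodule.lieSpan_le.mpr h)).resolve_left (isAtom_lieSpan hβ.1).1
      have hle : gt k θ H P ≤ J.toSubmodule := by
        rw [gt_eq_bracketSup]
        refine bracketSup_le (iSup₂_le fun β hβ ↦ ?_)
        rcases hβ with h | h
        · exact hJ β h
        · have := neg_rootSpace_le_ideal h.1 (hJ (-β) h)
          rwa [neg_neg] at this
      have hJtop : J = ⊤ := by
        rw [htop, top_le_iff] at hle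
        exact LieSubmodule.toSubmodule_injective hle
      exact hI.1 (hc.disjoint.eq_bot_of_le (hJtop ▸ le_top))
    · rintro ⟨N, hN, rfl⟩
      obtain ⟨β, hβ, rfl⟩ := (hk.mem_components hH).mp hN
      change IsAtom (LieSubmodule.lieSpan ℂ g (generated k H β : Set g))
      rw [lieSpan_generated]
      exact isAtom_lieSpan hβ.1
  rw [himage]
  refine Set.InjOn.ncard_image ?_
  intro N hN N' hN' h
  obtain ⟨β, hβ, rfl⟩ := (hk.mem_components hH).mp hN
  obtain ⟨γ, hγ, rfl⟩ := (hk.mem_components hH).mp hN'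
  change LieSubmodule.lieSpan ℂ g (generated k H β : Set g) =
    LieSubmodule.lieSpan ℂ g (generated k H γ : Set g) at h
  rw [lieSpan_generated, lieSpan_generated] at h
  obtain ⟨hβn, hβP⟩ := (hk.isTotallyPositive_iff hH).mp hβ
  obtain ⟨hγn, hγP⟩ := (hk.isTotallyPositive_iff hH).mp hγ
  have hS := hk.kstable_component hH hβn
  have hU := hS.union (hS.negSet hk hH)
  -- The ideal generated by g_β is contained in [m, m] + m for m built from ± the component of β. So
  -- γ is in this component up to sign, and positivity fixes the sign.
  have h1 : LieSubmodule.lieSpan ℂ g (rootSpace H β : Set g) ≤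
      hU.ideal hk hH (fun _ ↦ neg_mem_union_negSet) :=
    LieSubmodule.lieSpan_le.mpr
      (hU.rootSpace_le_ideal hk hH _ (Or.inl (mem_component_self hβ.1)))
  have h2 : (rootSpace H γ).toSubmodule ≤
      (hU.ideal hk hH (fun _ ↦ neg_mem_union_negSet)).toSubmodule := by
    rw [h] at h1
    exact LieSubmodule.subset_lieSpan.trans h1
  rcases hU.mem_of_rootSpace_le_ideal hk hH _ hγn h2 with h3 | h3
  · exact (hk.generated_eq hH hβ.1 h3).symm
  · exact absurd (hβP h3) (hP.neg_notMem γ (hγP (mem_component_self hγ.1)))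

end SimpleIdeals
end Ideals

/-! ### Positive systems containing `P_k`, and part (d). -/

section PositiveSystems

variable {H : LieSubalgebra ℂ g} [H.IsCartanSubalgebra]
variable {k : LieSubalgebra ℂ g} {θ : g ≃ₗ⁅ℂ⁆ g}

lemma IsPositiveSystem.compact_mem_iff {P P' : Set (Weight ℂ H g)} (hP : IsPositiveSystem H P)
    (hP' : IsPositiveSystem H P') (hk : IsPair k θ) (hH : H ≤ k)
    (h : compactPart k H P ⊆ P') {α : Weight ℂ H g} (hα : IsCompactRoot k H α) :
    α ∈ P' ↔ α ∈ P := by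
  refine ⟨fun h1 ↦ ?_, fun h1 ↦ h ⟨h1, hα⟩⟩
  refine (hP.mem_or_neg_mem α hα.1).resolve_right fun h2 ↦ ?_
  exact hP'.neg_notMem α h1 (h ⟨h2, hk.compact_neg hH hα⟩)

/-- A set of non-compact roots containing exactly one of any two opposite non-compact roots. -/
structure IsSignChoice (θ : g ≃ₗ⁅ℂ⁆ g) (S : Set (Weight ℂ H g)) : Prop where
  mem_or_neg_mem : ∀ γ, IsNoncompactRoot θ H γ → γ ∈ S ∨ -γ ∈ S
  neg_notMem : ∀ γ ∈ S, -γ ∉ S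

namespace IsPair

variable (hk : IsPair k θ) (hH : H ≤ k) {P : Set (Weight ℂ H g)} (hP : IsPositiveSystem H P)
include hk hH

lemma eq_compactPart_union {P' : Set (Weight ℂ H g)} (hP : IsPositiveSystem H P)
    (hP' : IsPositiveSystem H P') (h : compactPart k H P ⊆ P') :
    P' = compactPart k H P ∪ noncompactPart θ H P' := by
  ext α
  constructor
  · intro hα
    rcases hk.compact_or_noncompact hH (hP'.isRoot α hα) with h1 | h1
    · exact Or.inl ⟨(hP.compact_mem_iff hP' hk hH h h1).mp hα, h1⟩
    · exact Or.inr ⟨hα, h1⟩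
  · rintro (h1 | h1)
    exacts [h h1, h1.1]

lemma noncompactPart_union {S : Set (Weight ℂ H g)} (hS : ∀ β ∈ S, IsNoncompactRoot θ H β) :
    noncompactPart θ H (compactPart k H P ∪ S) = S := by
  ext α
  constructor
  · rintro ⟨h1 | h1, h2⟩
    · exact absurd h1.2 (hk.not_compact h2)
    · exact h1
  · intro h
    exact ⟨Or.inr h, hS α h⟩

lemma totallyPositive_union {S : Set (Weight ℂ H g)} (hS : KStable k θ S) :
    totallyPositiveRoots k θ H (compactPart k H P ∪ S) = S := by
  refine Set.Subset.antisymm ?_ fun β hβ ↦ ?_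
  · exact (hk.totallyPositive_subset hH).trans
      (hk.noncompactPart_union hH hS.noncompact).subset
  · exact (hk.isTotallyPositive_iff hH).mpr ⟨hS.noncompact β hβ,
      (hk.component_subset hH hS hβ).trans Set.subset_union_right⟩

include hP in
-- Closure under addition is automatic for two elements of `S`: by `k`-stability, a root β + γ would
-- put -γ in `S`, against the choice of signs.
lemma isPositiveSystem_union {S : Set (Weight ℂ H g)} (hS : KStable k θ S)
    (hc : IsSignChoice θ S) : IsPositiveSystem H (compactPart k H P ∪ S) where
  isRoot := by
    rintro α (h | h)
    exacts [h.2.1, (hS.noncompact α h).1]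
  mem_or_neg_mem := by
    intro α hα
    rcases hk.compact_or_noncompact hH hα with h | h
    · rcases hP.mem_or_neg_mem α hα with h1 | h1
      · exact Or.inl (Or.inl ⟨h1, h⟩)
      · exact Or.inr (Or.inl ⟨h1, hk.compact_neg hH h⟩)
    · rcases hc.mem_or_neg_mem α h with h1 | h1
      · exact Or.inl (Or.inr h1)
      · exact Or.inr (Or.inr h1)
  neg_notMem := by
    rintro α (h | h) (h' | h')
    · exact hP.neg_notMem α h.1 h'.1
    · exact hk.not_compact (hS.noncompact _ h') (hk.compact_neg hH h.2)
    · exact hk.not_compact (hk.noncompact_neg hH (hS.noncompact _ h)) h'.2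
    · exact hc.neg_notMem α h h'
  add_mem := by
    rintro α (h | h) β (h' | h') γ hγ hs
    · exact Or.inl ⟨hP.add_mem α h.1 β h'.1 γ hγ hs, hk.compact_add h.2 h'.2 hγ hs⟩
    · exact Or.inr (hS.add_mem β h' α h.2 γ hγ (by rw [hs, add_comm]))
    · exact Or.inr (hS.add_mem α h β h'.2 γ hγ hs)
    · exact absurd (hk.neg_mem_of_add hH hS h (hS.noncompact β h') hγ hs)
        (hc.neg_notMem β h')

end IsPair

lemma IsPositiveSystem.isSignChoice {P : Set (Weight ℂ H g)} (hP : IsPositiveSystem H P)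
    (hk : IsPair k θ) (hH : H ≤ k) : IsSignChoice θ (noncompactPart θ H P) where
  mem_or_neg_mem γ hγ := by
    rcases hP.mem_or_neg_mem γ hγ.1 with h | h
    · exact Or.inl ⟨h, hγ⟩
    · exact Or.inr ⟨h, hk.noncompact_neg hH hγ⟩
  neg_notMem γ hγ h := hP.neg_notMem γ hγ.1 h.1

lemma IsSignChoice.negSet {S : Set (Weight ℂ H g)} (hS : IsSignChoice θ S) :
    IsSignChoice θ (negSet H S) where
  mem_or_neg_mem γ hγ := (hS.mem_or_neg_mem γ hγ).symm.imp id fun h ↦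
    show - -γ ∈ S by rwa [neg_neg]
  neg_notMem γ hγ h := hS.neg_notMem (-γ) hγ h

namespace IsPair

variable (hk : IsPair k θ) (hH : H ≤ k) {P : Set (Weight ℂ H g)} (hP : IsPositiveSystem H P)
include hk hH hP

lemma isAdmissible_of_gt_eq_top (hg : LieAlgebra.IsSimple ℂ g)
    (htop : gt k θ H P = ⊤) : IsAdmissible k θ H P := by
  by_contra hne
  have h0 : totallyPositiveRoots k θ H P = ∅ := Set.not_nonempty_iff_eq_empty.mp hne
  have hle : gt k θ H P ≤ (⊥ : LieIdeal ℂ g).toSubmodule := by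
    rw [gt_eq_bracketSup]
    refine bracketSup_le (iSup₂_le fun β hβ ↦ ?_)
    rw [h0] at hβ
    exact (hβ.elim id id : β ∈ (∅ : Set (Weight ℂ H g))).elim
  rw [htop] at hle
  have := LieAlgebra.IsSimple.nontrivial ℂ g
  obtain ⟨x, hx⟩ := exists_ne (0 : g)
  exact hx (by simpa using hle (Submodule.mem_top (x := x)))

lemma ne_opposite (hne : IsAdmissible k θ H P) :
    P ≠ compactPart k H P ∪ negSet H (noncompactPart θ H P) := by
  obtain ⟨β, hβ⟩ := hne
  obtain ⟨h1, h2⟩ := hk.totallyPositive_subset hH hβ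
  intro h
  rw [h] at h1
  rcases h1 with h1 | h1
  · exact hk.not_compact h2 h1.2
  · exact hP.neg_notMem _ (hk.totallyPositive_subset hH hβ).1 h1.1

lemma admissible_iff_of_isSimple (hg : LieAlgebra.IsSimple ℂ g) (hne : IsAdmissible k θ H P)
    (P' : Set (Weight ℂ H g)) :
    (IsPositiveSystem H P' ∧ compactPart k H P ⊆ P' ∧ IsAdmissible k θ H P') ↔
      (P' = P ∨ P' = compactPart k H P ∪ negSet H (noncompactPart θ H P)) := by
  obtain ⟨β, hβ⟩ := hne
  obtain ⟨hβn, hβP⟩ := (hk.isTotallyPositive_iff hH).mp hβ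
  have hS := hk.kstable_component hH hβn
  have hU := hS.union (hS.negSet hk hH)
  -- By simplicity one component and its negative exhaust the non-compact roots, so an admissible
  -- system contains one of the two and is determined by which.
  have hall : ∀ γ, IsNoncompactRoot θ H γ →
      γ ∈ component k β ∨ γ ∈ negSet H (component k β) := fun γ hγ ↦
    hU.mem_of_isSimple hk hH (fun _ ↦ neg_mem_union_negSet) hg
      ⟨β, Or.inl (mem_component_self hβ.1)⟩ hγ
  have huniq : ∀ {P' : Set (Weight ℂ H g)}, IsPositiveSystem H P' → component k β ⊆ P' →
      noncompactPart θ H P' = component k β := by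
    intro P' hP' hsub
    refine Set.Subset.antisymm (fun γ hγ ↦ ?_) fun γ hγ ↦ ⟨hsub hγ, hS.noncompact γ hγ⟩
    exact (hall γ hγ.2).resolve_right fun h ↦ hP'.neg_notMem γ hγ.1 (hsub h)
  have huniq' : ∀ {P' : Set (Weight ℂ H g)}, IsPositiveSystem H P' →
      negSet H (component k β) ⊆ P' → noncompactPart θ H P' = negSet H (component k β) := by
    intro P' hP' hsub
    refine Set.Subset.antisymm (fun γ hγ ↦ ?_) fun γ hγ ↦
      ⟨hsub hγ, (hS.negSet hk hH).noncompact γ hγ⟩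
    refine (hall γ hγ.2).resolve_left fun h ↦ hP'.neg_notMem γ hγ.1 (hsub ?_)
    exact show - -γ ∈ component k β by rwa [neg_neg]
  have hPn : noncompactPart θ H P = component k β := huniq hP hβP
  constructor
  · rintro ⟨hP', hsub, γ, hγ⟩
    obtain ⟨hγn, hγP⟩ := (hk.isTotallyPositive_iff hH).mp hγ
    have hP'eq := hk.eq_compactPart_union hH hP hP' hsub
    rcases hall γ hγn with h | h
    · left
      rw [hk.component_eq hH hβ.1 h] at hγP
      rw [hP'eq, huniq hP' hγP, ← hPn]
      exact (hk.eq_compactPart_union hH hP hP fun _ h ↦ h.1).symm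
    · right
      have h1 : γ ∈ component k (-β) := by rw [hk.component_neg hH hβn]; exact h
      rw [hk.component_eq hH (neg_mem_root hβ.1) h1, hk.component_neg hH hβn] at hγP
      rw [hPn, ← huniq' hP' hγP]
      exact hP'eq
  · rintro (rfl | rfl)
    · exact ⟨hP, fun _ h ↦ h.1, β, hβ⟩
    · have hSn : KStable k θ (negSet H (noncompactPart θ H P)) := by
        rw [hPn]; exact hS.negSet hk hH
      refine ⟨hk.isPositiveSystem_union hH hP hSn (hP.isSignChoice hk hH).negSet,
        Set.subset_union_left, -β, ?_⟩
      rw [hk.totallyPositive_union hH hSn, hPn]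
      exact show - -β ∈ component k β by rw [neg_neg]; exact mem_component_self hβ.1

omit hP in
lemma mem_of_generated_eq {P' : Set (Weight ℂ H g)} {β γ : Weight ℂ H g}
    (hγ : γ ∈ H.root) (hβ : IsTotallyPositive k θ H P' β)
    (h : generated k H β = generated k H γ) : γ ∈ P' := by
  have h1 : γ ∈ component k β := ⟨hγ, by rw [h]; exact rootSpace_le_generated γ⟩
  exact ((hk.isTotallyPositive_iff hH).mp hβ).2 h1

/-! ### Counting positive systems by signs of components. -/

section Count

variable (hadm : IsAdmissible k θ H P)
  (hnt : noncompactPart θ H P = totallyPositiveRoots k θ H P)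

/-- The non-compact roots singled out by a set of `k`-submodules: those generating an element of
the set, and the negatives of those not doing so. -/
def choice (k : LieSubalgebra ℂ g) (θ : g ≃ₗ⁅ℂ⁆ g) (P : Set (Weight ℂ H g))
    (A : Set (LieSubmodule ℂ k g)) : Set (Weight ℂ H g) :=
  {γ | (γ ∈ noncompactPart θ H P ∧ generated k H γ ∈ A) ∨
    (-γ ∈ noncompactPart θ H P ∧ generated k H (-γ) ∉ A)}

omit hk hH hP in
lemma mem_choice_iff (hP : IsPositiveSystem H P) {A : Set (LieSubmodule ℂ k g)}
    {γ : Weight ℂ H g} (hγ : γ ∈ noncompactPart θ H P) :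
    γ ∈ choice k θ P A ↔ generated k H γ ∈ A := by
  refine ⟨fun h ↦ h.elim (·.2) fun h ↦ ?_, fun h ↦ Or.inl ⟨hγ, h⟩⟩
  exact absurd h.1.1 (hP.neg_notMem γ hγ.1)

include hnt

omit hP in
-- `P_n = P_t` makes `P_n` itself `k`-stable, and adding a compact root does not change the
-- generated module, so the sign is constant on components.
lemma kstable_choice (A : Set (LieSubmodule ℂ k g)) : KStable k θ (choice k θ P A) := by
  have hS := hk.kstable_totallyPositive hH P
  have hgen : ∀ β ∈ noncompactPart θ H P, ∀ α, IsCompactRoot k H α → ∀ γ ∈ H.root,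
      Weight.toLinear ℂ H g γ = Weight.toLinear ℂ H g β + Weight.toLinear ℂ H g α →
      γ ∈ noncompactPart θ H P ∧ generated k H γ = generated k H β := by
    intro β hβ α hα γ hγ hs
    refine ⟨hnt ▸ hS.add_mem β (hnt ▸ hβ) α hα γ hγ hs, ?_⟩
    exact hk.generated_eq hH hβ.2.1 ((hk.kstable_component hH hβ.2).add_mem β
      (mem_component_self hβ.2.1) α hα γ hγ hs)
  constructor
  · rintro β (⟨h, _⟩ | ⟨h, _⟩)
    · exact h.2
    · have := hk.noncompact_neg hH h.2
      rwa [neg_neg] at this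
  · rintro β (⟨h, hA⟩ | ⟨h, hA⟩) α hα γ hγ hs
    · obtain ⟨h1, h2⟩ := hgen β h α hα γ hγ hs
      exact Or.inl ⟨h1, h2 ▸ hA⟩
    · obtain ⟨h1, h2⟩ := hgen (-β) h (-α) (hk.compact_neg hH hα) (-γ) (neg_mem_root hγ)
        (by simp only [Weight.toLinear_neg, hs]; abel)
      exact Or.inr ⟨h1, h2 ▸ hA⟩

omit hnt in
lemma isSignChoice_choice (A : Set (LieSubmodule ℂ k g)) :
    IsSignChoice θ (choice k θ P A) := by
  have hPc := hP.isSignChoice hk hH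
  constructor
  · intro γ hγ
    rcases hPc.mem_or_neg_mem γ hγ with h | h
    · by_cases hA : generated k H γ ∈ A
      · exact Or.inl (Or.inl ⟨h, hA⟩)
      · exact Or.inr (Or.inr (by rw [neg_neg]; exact ⟨h, hA⟩))
    · by_cases hA : generated k H (-γ) ∈ A
      · exact Or.inr (Or.inl ⟨h, hA⟩)
      · exact Or.inl (Or.inr ⟨h, hA⟩)
  · rintro γ (h | h) (h' | h')
    · exact hPc.neg_notMem γ h.1 h'.1
    · rw [neg_neg] at h'
      exact h'.2 h.2
    · exact h.2 h'.2
    · exact hPc.neg_notMem (-γ) h.1 h'.1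

include hadm

lemma ncard_positiveSystems :
    {P' : Set (Weight ℂ H g) | IsPositiveSystem H P' ∧ compactPart k H P ⊆ P' ∧
      IsAdmissible k θ H P' ∧
      noncompactPart θ H P' = totallyPositiveRoots k θ H P'}.ncard =
      2 ^ (components k θ H P).ncard := by
  have hfin : (components k θ H P).Finite := by
    refine (Set.toFinite (Set.range (generated k H))).subset fun N hN ↦ ?_
    obtain ⟨β, _, h⟩ := (hk.mem_components hH).mp hN
    exact ⟨β, h⟩
  have himage : {P' : Set (Weight ℂ H g) | IsPositiveSystem H P' ∧ compactPart k H P ⊆ P' ∧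
      IsAdmissible k θ H P' ∧
      noncompactPart θ H P' = totallyPositiveRoots k θ H P'} =
      (fun A ↦ compactPart k H P ∪ choice k θ P A) '' (𝒫 components k θ H P) := by
    ext P'
    constructor
    · rintro ⟨hP', hsub, -, hnt'⟩
      -- The subset attached to `P'` consists of the components having some root in `P'`; since
      -- `P'_n = P'_t`, all roots of such a component are in `P'`.
      refine ⟨{N | ∃ β, IsTotallyPositive k θ H P β ∧ β ∈ P' ∧ generated k H β = N}, ?_, ?_⟩
      · rintro _ ⟨β, hβ, _, rfl⟩
        exact (hk.mem_components hH).mpr ⟨β, hβ, rfl⟩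
      · have key : ∀ γ ∈ noncompactPart θ H P, generated k H γ ∈
            {N | ∃ β, IsTotallyPositive k θ H P β ∧ β ∈ P' ∧ generated k H β = N} ↔ γ ∈ P' := by
          intro γ hγ
          constructor
          · rintro ⟨β, hβ, hβ', h⟩
            have : β ∈ totallyPositiveRoots k θ H P' :=
              hnt' ▸ ⟨hβ', (hk.totallyPositive_subset hH hβ).2⟩
            exact hk.mem_of_generated_eq hH hγ.2.1 this h
          · intro h
            exact ⟨γ, (hnt ▸ hγ : γ ∈ totallyPositiveRoots k θ H P), h, rfl⟩
        refine Eq.trans ?_ (hk.eq_compactPart_union hH hP hP' hsub).symm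
        refine congrArg (compactPart k H P ∪ ·) (Set.ext fun γ ↦ ?_)
        constructor
        · rintro (⟨h, hA⟩ | ⟨h, hA⟩)
          · exact ⟨(key γ h).mp hA, h.2⟩
          · have hn := hk.noncompact_neg hH h.2
            rw [neg_neg] at hn
            exact ⟨(hP'.mem_or_neg_mem γ hn.1).resolve_right
              fun h' ↦ hA ((key (-γ) h).mpr h'), hn⟩
        · rintro ⟨h, hn⟩
          rcases (hP.isSignChoice hk hH).mem_or_neg_mem γ hn with h' | h'
          · exact Or.inl ⟨h', (key γ h').mpr h⟩
          · exact Or.inr ⟨h', fun hA ↦ hP'.neg_notMem γ h ((key (-γ) h').mp hA)⟩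
    · rintro ⟨A, -, rfl⟩
      have hS := hk.kstable_choice hH hnt A
      have hc := hk.isSignChoice_choice hH hP A
      have ht := hk.totallyPositive_union hH (P := P) hS
      refine ⟨hk.isPositiveSystem_union hH hP hS hc, Set.subset_union_left, ?_, ?_⟩
      -- Admissibility of `P` is needed only to supply a non-compact root; one of ±β is then chosen.
      · obtain ⟨β, hβ⟩ := hadm
        have hβn := ((hk.totallyPositive_subset hH) hβ).2
        change (totallyPositiveRoots k θ H _).Nonempty
        rw [ht]
        rcases hc.mem_or_neg_mem β hβn with h | h
        exacts [⟨β, h⟩, ⟨-β, h⟩]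
      · rw [ht, hk.noncompactPart_union hH hS.noncompact]
  rw [himage, Set.InjOn.ncard_image, Set.ncard_powerset _ hfin]
  -- A subset is recovered from its system: a root of `P_n` is chosen exactly when the module it
  -- generates is in the subset.
  have hle : ∀ A ∈ 𝒫 components k θ H P, ∀ B : Set (LieSubmodule ℂ k g),
      compactPart k H P ∪ choice k θ P A = compactPart k H P ∪ choice k θ P B → A ⊆ B := by
    intro A hA B hAB N hN
    have h1 : choice k θ P A = choice k θ P B := by
      rw [← hk.noncompactPart_union hH (P := P) (hk.kstable_choice hH hnt A).noncompact, hAB,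
        hk.noncompactPart_union hH (hk.kstable_choice hH hnt B).noncompact]
    obtain ⟨β, hβ, rfl⟩ := (hk.mem_components hH).mp (hA hN)
    have hβn := hk.totallyPositive_subset hH hβ
    rwa [← mem_choice_iff hP hβn, ← h1, mem_choice_iff hP hβn]
  exact fun A hA B hB h ↦ (hle A hA B h).antisymm (hle B hB A h.symm)

omit hadm in
-- The roots of every component lie in `P`, so the sign is decided by which of ±γ is positive, and
-- the component is the module generated by that root.
lemma existsUnique_signed {γ : Weight ℂ H g} (hγ : IsNoncompactRoot θ H γ) :
    ∃! q : LieSubmodule ℂ k g × Bool, q.1 ∈ components k θ H P ∧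
      (rootSpace H γ).toSubmodule ≤ signed k H q.1 q.2 := by
  have hpos : ∀ δ, IsNoncompactRoot θ H δ → δ ∈ P → IsTotallyPositive k θ H P δ :=
    fun δ h1 h2 ↦ (hnt ▸ (⟨h2, h1⟩ : δ ∈ noncompactPart θ H P) :
      δ ∈ totallyPositiveRoots k θ H P)
  have hopp : ∀ β : Weight ℂ H g, (rootSpace H γ).toSubmodule ≤ signed k H (generated k H β) false ↔
      -γ ∈ component k β := fun β ↦ rootSpace_le_rootSpan_iff
  have htrue : ∀ β : Weight ℂ H g, (rootSpace H γ).toSubmodule ≤ signed k H (generated k H β) true ↔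
      γ ∈ component k β := fun β ↦ ⟨fun h ↦ ⟨hγ.1, h⟩, fun h ↦ h.2⟩
  have hmem : ∀ {β δ}, IsTotallyPositive k θ H P β → δ ∈ component k β →
      δ ∈ P ∧ generated k H β = generated k H δ := fun {β δ} hβ hδ ↦
    ⟨((hk.isTotallyPositive_iff hH).mp hβ).2 hδ, (hk.generated_eq hH hβ.1 hδ).symm⟩
  rcases hP.mem_or_neg_mem γ hγ.1 with h | h
  · refine ⟨(generated k H γ, true), ⟨(hk.mem_components hH).mpr ⟨γ, hpos γ hγ h, rfl⟩,
      (htrue γ).mpr (mem_component_self hγ.1)⟩, ?_⟩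
    rintro ⟨N, ε⟩ ⟨hN, hle⟩
    obtain ⟨β, hβ, rfl⟩ := (hk.mem_components hH).mp hN
    cases ε
    · exact absurd (hmem hβ ((hopp β).mp hle)).1 (hP.neg_notMem γ h)
    · exact Prod.ext (hmem hβ ((htrue β).mp hle)).2 rfl
  · refine ⟨(generated k H (-γ), false), ⟨(hk.mem_components hH).mpr
      ⟨-γ, hpos (-γ) (hk.noncompact_neg hH hγ) h, rfl⟩,
      (hopp (-γ)).mpr (mem_component_self (neg_mem_root hγ.1))⟩, ?_⟩
    rintro ⟨N, ε⟩ ⟨hN, hle⟩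
    obtain ⟨β, hβ, rfl⟩ := (hk.mem_components hH).mp hN
    cases ε
    · exact Prod.ext (hmem hβ ((hopp β).mp hle)).2 rfl
    · exact absurd h (hP.neg_notMem γ (hmem hβ ((htrue β).mp hle)).1)

end Count
end IsPair
end PositiveSystems

end HarishChandra

theorem proposition1 {g : Type*} [LieRing g] [LieAlgebra ℂ g] [FiniteDimensional ℂ g]
    [LieAlgebra.IsSemisimple ℂ g]
    (k : LieSubalgebra ℂ g) (θ : g ≃ₗ⁅ℂ⁆ g) (hk : HarishChandra.IsPair k θ)
    (H : LieSubalgebra ℂ g) [H.IsCartanSubalgebra] (hH : H ≤ k)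
    (P : Set (Weight ℂ H g)) (hP : HarishChandra.IsPositiveSystem H P) :
    -- (a)
    (∀ β, HarishChandra.IsTotallyPositive k θ H P β →
      LieModule.IsIrreducible ℂ k (HarishChandra.generated k H β) ∧
      ∀ γ ∈ H.root,
        Weight.toLinear ℂ H g γ - Weight.toLinear ℂ H g β ∈
          Submodule.span ℤ {l | ∃ α, HarishChandra.IsCompactRoot k H α ∧
            Weight.toLinear ℂ H g α = l} →
        HarishChandra.IsTotallyPositive k θ H P γ ∧
        (rootSpace H γ).toSubmodule ≤ (HarishChandra.generated k H β).toSubmodule) ∧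
    -- (b)
    (∀ γ α, HarishChandra.IsTotallyPositive k θ H P γ → HarishChandra.IsCompactRoot k H α →
      {δ : Weight ℂ H g | δ ∈ H.root ∧ ∃ n : ℤ,
        Weight.toLinear ℂ H g δ =
          Weight.toLinear ℂ H g γ + n • Weight.toLinear ℂ H g α}.encard ≤ 3) ∧
    -- (c)
    (LieAlgebra.IsSimple ℂ g →
      (∀ β, ¬ HarishChandra.IsTotallyPositive k θ H P β) ∨
      (∀ β ∈ HarishChandra.noncompactPart θ H P, HarishChandra.IsTotallyPositive k θ H P β)) ∧
    -- (d), the simple case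
    (LieAlgebra.IsSimple ℂ g → HarishChandra.gt k θ H P = ⊤ →
      P ≠ HarishChandra.compactPart k H P ∪
          HarishChandra.negSet H (HarishChandra.noncompactPart θ H P) ∧
      ∀ P' : Set (Weight ℂ H g),
        (HarishChandra.IsPositiveSystem H P' ∧ HarishChandra.compactPart k H P ⊆ P' ∧
          HarishChandra.IsAdmissible k θ H P') ↔
        (P' = P ∨ P' = HarishChandra.compactPart k H P ∪
          HarishChandra.negSet H (HarishChandra.noncompactPart θ H P))) ∧
    -- (d), the general case
    (HarishChandra.IsAdmissible k θ H P →
      HarishChandra.noncompactPart θ H P = HarishChandra.totallyPositiveRoots k θ H P →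
      {P' : Set (Weight ℂ H g) | HarishChandra.IsPositiveSystem H P' ∧
        HarishChandra.compactPart k H P ⊆ P' ∧ HarishChandra.IsAdmissible k θ H P' ∧
        HarishChandra.noncompactPart θ H P' =
          HarishChandra.totallyPositiveRoots k θ H P'}.ncard =
        2 ^ (HarishChandra.components k θ H P).ncard ∧
      (HarishChandra.gt k θ H P = ⊤ →
        {I : LieIdeal ℂ g | LieAlgebra.IsSimple ℂ I}.ncard =
          (HarishChandra.components k θ H P).ncard) ∧
      ∀ γ, HarishChandra.IsNoncompactRoot θ H γ →
        ∃! q : LieSubmodule ℂ k g × Bool, q.1 ∈ HarishChandra.components k θ H P ∧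
          (rootSpace H γ).toSubmodule ≤ HarishChandra.signed k H q.1 q.2) := by
  refine ⟨fun β hβ ↦ ⟨?_, fun γ hγ h ↦ ?_⟩, fun γ α hγ hα ↦ hk.encard_string_le hH hP hγ hα,
    fun hg ↦ ?_, fun hg htop ↦ ?_, fun hadm hnt ↦ ⟨hk.ncard_positiveSystems hH hP hadm hnt,
      hk.ncard_simple_ideals hH hP, fun γ hγ ↦ hk.existsUnique_signed hH hP hnt hγ⟩⟩
  · exact (HarishChandra.isIrreducible_iff_isAtom _).mpr (hk.isAtom_generated hH hβ.1)
  · have h1 := hk.mem_component_of_sub_mem_span hH hP hβ hγ h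
    obtain ⟨h2, h3⟩ := (hk.isTotallyPositive_iff hH).mp hβ
    refine ⟨(hk.isTotallyPositive_iff hH).mpr
      ⟨(hk.kstable_component hH h2).noncompact γ h1, ?_⟩, h1.2⟩
    rwa [hk.component_eq hH hβ.1 h1]
  · by_cases hne : HarishChandra.IsAdmissible k θ H P
    · exact Or.inr fun β hβ ↦ hk.totallyPositive_of_isSimple hH hg hP hne hβ
    · exact Or.inl fun β hβ ↦ hne ⟨β, hβ⟩
  · have hne := hk.isAdmissible_of_gt_eq_top hH hP hg htop
    exact ⟨hk.ne_opposite hH hP hne, hk.admissible_iff_of_isSimple hH hP hg hne⟩
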